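/- Let $\mathbb{O}_c$ be the compact real Cayley algebra, of dimension $8$, with norm $n$ and Cayley conjugation $a\mapsto\tilde a$, and put $(a:b)=n(a+b)-n(a)-n(b)$. Let $\mathbb{O}=\mathbb{C}\otimes_{\mathbb{R}}\mathbb{O}_c$ be the algebra of complex octonions; product, norm, scalar product $(\,:\,)$ and Cayley conjugation are extended complex (bi)linearly or quadratically, and $a\mapsto\bar a$ denotes the complex conjugation of $\mathbb{O}$ with respect to $\mathbb{O}_c$. Let $V=H_3(\mathbb{O})$ be the $27$-dimensional complex vector space of $3\times3$ matrices over $\mathbb{O}$ that are Hermitian with respect to the Cayley conjugation, written $$a=\sum_i\alpha_ie_i+\sum_iF_i(a_i)=\begin{pmatrix}\alpha_1&a_3&\tilde a_2\\ \tilde a_3&\alpha_2&a_1\\ a_2&\tilde a_1&\alpha_3\end{pmatrix},\qquad \alpha_i\in\mathbb{C},\ a_i\in\mathbb{O}.$$ Put $(a:b)=\sum_i\alpha_i\beta_i+\sum_i(a_i:b_i)$, $\ \bar a=\sum_i\bar\alpha_ie_i+\sum_iF_i(\bar a_i)$, $\ (a\mid b)=(a:\bar b)$, $$a^{\#}=\sum_i(\alpha_j\alpha_k-n(a_i))e_i+\sum_iF_i\big((a_ja_k-\alpha_i\tilde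 a_i)^{\sim}\big)$$ (with $(i,j,k)$ an even permutation of $(1,2,3)$), $\ a\times b=(a+b)^{\#}-a^{\#}-b^{\#}$, and $$D(x,y)z=\{xyz\}=(x\mid y)z+(z\mid y)x-(x\times z)\times\bar y .$$ **Theorem.** With this triple product, $V=H_3(\mathbb{O})$ is a positive Hermitian Jordan triple system; it is simple and of tube type, and its numerical invariants are $$a=8,\qquad b=0,\qquad r=3,\qquad g=18.$$ Here the terms have the following meaning. Put $Q(x)y=\frac12\{xyx\}$. *Hermitian Jordan triple system*: $V$ is finite-dimensional, $\{xyz\}$ is complex bilinear and symmetric in $(x,z)$ and antilinear in $y$, and $D(x,y)Q(x)=Q(x)D(y,x)$, $D(Q(x)y,y)=D(x,Q(y)x)$. *Positive*: $(x,y)\mapsto\operatorname{Tr}D(x,y)$ is a positive definite Hermitian form. *Simple*: the triple product is not zero, and the only complex subspaces $I$ with $\{IVV\}\subset I$ and $\{VIV\}\subset I$ are $0$ and $V$. A *tripotent* is an $e$ with $Q(e)e=e$; tripotents $e,f$ are *orthogonal* if $D(e,f)=0$; a *minimal* tripotent is a non-zero tripotent that is not a sum of two non-zero orthogonal tripotents;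 a *frame* is a maximal family of pairwise orthogonal minimal tripotents. *Tube type*: there is a tripotent $e$ with $V_2(e)=\{y: D(e,e)y=2y\}=V$. The *rank* $r$ is the degree of the generic minimal polynomial, that is, the largest dimension, over $x,y\in V$, of the span of the powers $x^{(1,y)}=x$, $x^{(k+1,y)}=\frac12D(x,y)x^{(k,y)}$. For a frame $(c_1,\dots,c_r)$ let $V_{ij}=\{z: D(c_k,c_k)z=(\delta_{ik}+\delta_{jk})z,\ 1\le k\le r\}$ for $0\le i\le j\le r$. Then $a=\dim_{\mathbb{C}}V_{ij}$ for $1\le i<j\le r$, $b=\dim_{\mathbb{C}}V_{0i}$ for $1\le i\le r$, and $g=2+a(r-1)+b$; it is part of the claim that frames exist, that every frame has $r$ elements, and that these dimensions are the same for every frame and all such $i,j$. -/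

import Mathlib

/-! ### Hermitian Jordan triple systems

A triple product on a complex vector space `V` is a map `T`, complex linear in the outer two
variables and antilinear in the middle one; `T x y z` stands for `{x y z}`, so that the linear
operator `T x y` is `D(x, y)`. -/

namespace HermitianJTS

/-- Maps `(x, y, z) ↦ {x y z}` that are linear in `x`, antilinear in `y` and linear in `z`. -/
abbrev TripleProduct (V : Type*) [AddCommGroup V] [Module ℂ V] : Type _ :=
  V →ₗ[ℂ] V →ₛₗ[starRingEnd ℂ] V →ₗ[ℂ] V

variable {V : Type*} [AddCommGroup V] [Module ℂ V]

/-- The quadratic operator `Q(x) y = ½ {x y x}`. -/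
noncomputable def Q (T : TripleProduct V) (x y : V) : V := (1 / 2 : ℂ) • T x y x

/-- `T` is a Hermitian Jordan triple system: symmetry in the outer variables and the identities
`D(x,y) Q(x) = Q(x) D(y,x)` and `D(Q(x)y, y) = D(x, Q(y)x)`, in finite dimension. -/
structure IsHermitianJTS (T : TripleProduct V) : Prop where
  finiteDimensional : FiniteDimensional ℂ V
  symm : ∀ x y z : V, T x y z = T z y x
  j1 : ∀ x y u : V, T x y (Q T x u) = Q T x (T y x u)
  j2 : ∀ x y z : V, T (Q T x y) y z = T x (Q T y x) z

/-- Positivity: `(x, y) ↦ Tr D(x, y)` is a positive definite Hermitian form. -/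
structure IsPositive (T : TripleProduct V) : Prop where
  hermitian : ∀ x y : V,
    LinearMap.trace ℂ V (T x y) = starRingEnd ℂ (LinearMap.trace ℂ V (T y x))
  pos : ∀ x : V, x ≠ 0 → 0 < (LinearMap.trace ℂ V (T x x)).re

/-- Ideals of a triple system. -/
def IsIdeal (T : TripleProduct V) (I : Submodule ℂ V) : Prop :=
  ∀ x ∈ I, ∀ y z : V, T x y z ∈ I ∧ T y x z ∈ I ∧ T y z x ∈ I

/-- Simplicity: the triple product is non-zero and there are no proper non-zero ideals. -/
def IsSimple (T : TripleProduct V) : Prop :=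
  T ≠ 0 ∧ ∀ I : Submodule ℂ V, IsIdeal T I → I = ⊥ ∨ I = ⊤

/-- Tripotents: `x⁽³⁾ = Q(x) x = x`. -/
def IsTripotent (T : TripleProduct V) (x : V) : Prop := Q T x x = x

/-- Orthogonality of tripotents: `D(x, y) = 0`. -/
def IsOrthogonal (T : TripleProduct V) (x y : V) : Prop := T x y = 0

/-- Minimal tripotents: non-zero tripotents that are not the sum of two non-zero orthogonal
tripotents. -/
def IsMinimalTripotent (T : TripleProduct V) (x : V) : Prop :=
  IsTripotent T x ∧ x ≠ 0 ∧
    ∀ u v : V, IsTripotent T u → IsTripotent T v → IsOrthogonal T u v → x = u + v →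
      u = 0 ∨ v = 0

/-- Frames: maximal families of pairwise orthogonal minimal tripotents. -/
structure IsFrame (T : TripleProduct V) {n : ℕ} (c : Fin n → V) : Prop where
  minimal : ∀ i, IsMinimalTripotent T (c i)
  orthogonal : ∀ i j, i ≠ j → IsOrthogonal T (c i) (c j)
  maximal : ¬ ∃ e : V, IsMinimalTripotent T e ∧ ∀ i, IsOrthogonal T e (c i)

/-- The Peirce space `V_j(x)`: the eigenspace of `D(x, x)` for the eigenvalue `j`. -/
def peirce (T : TripleProduct V) (x : V) (j : ℕ) : Submodule ℂ V :=
  Module.End.eigenspace (T x x) (j : ℂ)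

/-- The simultaneous Peirce space `V_{ij}`, `0 ≤ i, j ≤ n`, of a family `c₁, …, cₙ` of
orthogonal tripotents: the `z` with `D(c_k, c_k) z = (δ_{ik} + δ_{jk}) z` for `k = 1, …, n`.
As `c` is indexed by `Fin n`, the tripotent with (one-based) number `k.succ` is `c k`. -/
def jointPeirce (T : TripleProduct V) {n : ℕ} (c : Fin n → V) (i j : Fin (n + 1)) :
    Submodule ℂ V :=
  ⨅ k : Fin n, peirce T (c k) ((if i = k.succ then 1 else 0) + (if j = k.succ then 1 else 0))

/-- Tube type: some tripotent `e` has `V_2(e) = V`. -/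
def IsTubeType (T : TripleProduct V) : Prop :=
  ∃ e : V, IsTripotent T e ∧ peirce T e 2 = ⊤

/-- The powers: `power T x y k` is `x^{(k+1, y)}`, where `x^{(1, y)} = x` and
`x^{(k+1, y)} = ½ D(x, y) x^{(k, y)}`. -/
noncomputable def power (T : TripleProduct V) (x y : V) : ℕ → V
  | 0 => x
  | k + 1 => (1 / 2 : ℂ) • T x y (power T x y k)

/-- The degree of the minimal polynomial of `x` in `V^{(y)}`, that is, the dimension of the
span of the powers `x^{(k, y)}`, `k ≥ 1`. -/
noncomputable def minpolyDegree (T : TripleProduct V) (x y : V) : ℕ :=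
  Module.finrank ℂ (Submodule.span ℂ (Set.range (power T x y)))

/-- The rank: the degree of the generic minimal polynomial, that is, the largest degree of
the minimal polynomial of an `x` in a `V^{(y)}`. -/
def HasRank (T : TripleProduct V) (r : ℕ) : Prop :=
  IsGreatest {d : ℕ | ∃ x y : V, minpolyDegree T x y = d} r

/-- `a`, `b`, `r`, `g` are the numerical invariants: `r` is the rank; frames exist and all have
`r` elements; `a` and `b` are, for every frame, the common dimensions of the `V_{ij}`
(`1 ≤ i < j ≤ r`) and of the `V_{0i}` (`1 ≤ i ≤ r`); the genus is `g = 2 + a (r - 1) + b`. -/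
structure HasNumericalInvariants (T : TripleProduct V) (a b r g : ℕ) : Prop where
  rank : HasRank T r
  exists_frame : ∃ c : Fin r → V, IsFrame T c
  frame_length : ∀ (n : ℕ) (c : Fin n → V), IsFrame T c → n = r
  finrank_a : ∀ c : Fin r → V, IsFrame T c → ∀ i j : Fin r, i < j →
    Module.finrank ℂ (jointPeirce T c i.succ j.succ) = a
  finrank_b : ∀ c : Fin r → V, IsFrame T c → ∀ i : Fin r,
    Module.finrank ℂ (jointPeirce T c 0 i.succ) = b
  genus : (g : ℤ) = 2 + (a : ℤ) * ((r : ℤ) - 1) + (b : ℤ)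

end HermitianJTS

/-! ### Octonions

The Cayley algebra over `k`, as the Cayley–Dickson extension with parameter `-1` of the
quaternions over `k`. `Octonion ℝ` is the compact Cayley algebra, and `Octonion ℂ` is its
complexification. -/

/-- Pairs `(a, b)`, written `a + v b`, of quaternions over `k`. -/
def Octonion (k : Type*) [CommRing k] : Type _ := Quaternion k × Quaternion k

namespace Octonion

variable {k : Type*} [CommRing k]

instance : AddCommGroup (Octonion k) := inferInstanceAs (AddCommGroup (Quaternion k × Quaternion k))

instance : Module k (Octonion k) := inferInstanceAs (Module k (Quaternion k × Quaternion k))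

instance : Module.Finite k (Octonion k) :=
  inferInstanceAs (Module.Finite k (Quaternion k × Quaternion k))

/-- `(a₁ + v b₁) (a₂ + v b₂) = a₁ a₂ - b₂ b̃₁ + v (ã₁ b₂ + a₂ b₁)`. -/
instance : Mul (Octonion k) :=
  ⟨fun x y => (x.1 * y.1 - y.2 * star x.2, star x.1 * y.2 + y.1 * x.2)⟩

/-- The scalars `λ e`. -/
def scalar (t : k) : Octonion k := ((t : Quaternion k), 0)

instance : One (Octonion k) := ⟨scalar 1⟩

/-- The Cayley conjugation `(a + v b)~ = ã - v b`; it is `k`-linear, also for `k = ℂ`. -/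
instance : Star (Octonion k) := ⟨fun x => (star x.1, -x.2)⟩

/-- The norm `n(a + v b) = n(a) + n(b)`. -/
def norm (x : Octonion k) : k := Quaternion.normSq x.1 + Quaternion.normSq x.2

/-- The scalar product `(x : y) = n(x + y) - n(x) - n(y)`. -/
def inner (x y : Octonion k) : k := norm (x + y) - norm x - norm y

/-- Coordinatewise application of a ring homomorphism. -/
def map {l : Type*} [CommRing l] (f : k →+* l) (x : Octonion k) : Octonion l :=
  (⟨f x.1.re, f x.1.imI, f x.1.imJ, f x.1.imK⟩, ⟨f x.2.re, f x.2.imI, f x.2.imJ, f x.2.imK⟩)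

/-- The complex conjugation of `Octonion ℂ` with respect to its real form `Octonion ℝ`. -/
noncomputable def conj (x : Octonion ℂ) : Octonion ℂ := map (starRingEnd ℂ) x

@[ext] theorem ext {x y : Octonion k} (h₁ : x.1 = y.1) (h₂ : x.2 = y.2) : x = y :=
  Prod.ext h₁ h₂

@[simp] theorem add_fst (x y : Octonion k) : (x + y).1 = x.1 + y.1 := rfl
@[simp] theorem add_snd (x y : Octonion k) : (x + y).2 = x.2 + y.2 := rfl
@[simp] theorem sub_fst (x y : Octonion k) : (x - y).1 = x.1 - y.1 := rfl
@[simp] theorem sub_snd (x y : Octonion k) : (x - y).2 = x.2 - y.2 := rfl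
@[simp] theorem neg_fst (x : Octonion k) : (-x).1 = -x.1 := rfl
@[simp] theorem neg_snd (x : Octonion k) : (-x).2 = -x.2 := rfl
@[simp] theorem zero_fst : (0 : Octonion k).1 = 0 := rfl
@[simp] theorem zero_snd : (0 : Octonion k).2 = 0 := rfl
@[simp] theorem smul_fst (t : k) (x : Octonion k) : (t • x).1 = t • x.1 := rfl
@[simp] theorem smul_snd (t : k) (x : Octonion k) : (t • x).2 = t • x.2 := rfl
@[simp] theorem mul_fst (x y : Octonion k) : (x * y).1 = x.1 * y.1 - y.2 * star x.2 := rfl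
@[simp] theorem mul_snd (x y : Octonion k) : (x * y).2 = star x.1 * y.2 + y.1 * x.2 := rfl
@[simp] theorem star_fst (x : Octonion k) : (star x).1 = star x.1 := rfl
@[simp] theorem star_snd (x : Octonion k) : (star x).2 = -x.2 := rfl
@[simp] theorem scalar_fst (t : k) : (scalar t).1 = (t : Quaternion k) := rfl
@[simp] theorem scalar_snd (t : k) : (scalar t).2 = 0 := rfl

@[simp] theorem map_fst_re {l : Type*} [CommRing l] (f : k →+* l) (x : Octonion k) :
    (map f x).1.re = f x.1.re := rfl
@[simp] theorem map_fst_imI {l : Type*} [CommRing l] (f : k →+* l) (x : Octonion k) :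
    (map f x).1.imI = f x.1.imI := rfl
@[simp] theorem map_fst_imJ {l : Type*} [CommRing l] (f : k →+* l) (x : Octonion k) :
    (map f x).1.imJ = f x.1.imJ := rfl
@[simp] theorem map_fst_imK {l : Type*} [CommRing l] (f : k →+* l) (x : Octonion k) :
    (map f x).1.imK = f x.1.imK := rfl
@[simp] theorem map_snd_re {l : Type*} [CommRing l] (f : k →+* l) (x : Octonion k) :
    (map f x).2.re = f x.2.re := rfl
@[simp] theorem map_snd_imI {l : Type*} [CommRing l] (f : k →+* l) (x : Octonion k) :
    (map f x).2.imI = f x.2.imI := rfl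
@[simp] theorem map_snd_imJ {l : Type*} [CommRing l] (f : k →+* l) (x : Octonion k) :
    (map f x).2.imJ = f x.2.imJ := rfl
@[simp] theorem map_snd_imK {l : Type*} [CommRing l] (f : k →+* l) (x : Octonion k) :
    (map f x).2.imK = f x.2.imK := rfl

theorem oct_add_mul (x y z : Octonion k) : (x + y) * z = x * z + y * z := by
  ext : 1 <;> simp [add_mul, mul_add] <;> abel

theorem oct_mul_add (x y z : Octonion k) : x * (y + z) = x * y + x * z := by
  ext : 1 <;> simp [add_mul, mul_add] <;> abel

theorem oct_smul_mul (t : k) (x y : Octonion k) : (t • x) * y = t • (x * y) := by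
  ext <;> simp <;> ring

theorem oct_mul_smul (t : k) (x y : Octonion k) : x * (t • y) = t • (x * y) := by
  ext <;> simp <;> ring

theorem oct_star_add (x y : Octonion k) : star (x + y) = star x + star y := by
  ext : 1
  · simp
  · simp [add_comm]

theorem oct_star_smul (t : k) (x : Octonion k) : star (t • x) = t • star x := by
  ext <;> simp

theorem oct_star_star (x : Octonion k) : star (star x) = x := by
  ext <;> simp

/-- The norm is `x x̃`. -/
theorem mul_star' (x : Octonion k) : x * star x = scalar (norm x) := by
  ext <;> simp [norm, Quaternion.normSq_def', -Quaternion.coe_add, -Quaternion.coe_pow] <;> ring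

theorem inner_eq (x y : Octonion k) : inner x y =
    2 * (x.1.re * y.1.re + x.1.imI * y.1.imI + x.1.imJ * y.1.imJ + x.1.imK * y.1.imK +
      x.2.re * y.2.re + x.2.imI * y.2.imI + x.2.imJ * y.2.imJ + x.2.imK * y.2.imK) := by
  simp only [inner, norm, Quaternion.normSq_def', add_fst, add_snd, Quaternion.re_add,
    Quaternion.imI_add, Quaternion.imJ_add, Quaternion.imK_add]
  ring

/-- Coordinatewise ring homomorphisms are compatible with the product. -/
theorem map_mul' {l : Type*} [CommRing l] (f : k →+* l) (x y : Octonion k) :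
    map f (x * y) = map f x * map f y := by
  ext <;> simp

/-- `Octonion ℂ` is the complexification of `Octonion ℝ`. -/
theorem existsUnique_real_imag (z : Octonion ℂ) : ∃! p : Octonion ℝ × Octonion ℝ,
    z = map Complex.ofRealHom p.1 + Complex.I • map Complex.ofRealHom p.2 := by
  let p : Octonion ℝ := (⟨z.1.re.re, z.1.imI.re, z.1.imJ.re, z.1.imK.re⟩,
    ⟨z.2.re.re, z.2.imI.re, z.2.imJ.re, z.2.imK.re⟩)
  let q : Octonion ℝ := (⟨z.1.re.im, z.1.imI.im, z.1.imJ.im, z.1.imK.im⟩,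
    ⟨z.2.re.im, z.2.imI.im, z.2.imJ.im, z.2.imK.im⟩)
  refine ⟨(p, q), ?_, ?_⟩
  · ext <;> simp [Complex.ext_iff] <;> exact ⟨rfl, rfl⟩
  · rintro ⟨p', q'⟩ h
    have e : ∀ w, z = w → z.1 = w.1 ∧ z.2 = w.2 := by rintro w rfl; exact ⟨rfl, rfl⟩
    have h' := e _ h
    simp only [Quaternion.ext_iff, Complex.ext_iff] at h'
    simp at h'
    refine Prod.ext ?_ ?_ <;> ext <;> simp [p, q, h']

/-- The complex conjugation fixes the real form and is antilinear. -/
theorem conj_real_imag (x y : Octonion ℝ) :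
    conj (map Complex.ofRealHom x + Complex.I • map Complex.ofRealHom y) =
      map Complex.ofRealHom x - Complex.I • map Complex.ofRealHom y := by
  ext <;> simp [conj, sub_eq_add_neg]

theorem conj_add (x y : Octonion ℂ) : conj (x + y) = conj x + conj y := by
  ext <;> simp [conj]

theorem conj_smul (t : ℂ) (x : Octonion ℂ) : conj (t • x) = starRingEnd ℂ t • conj x := by
  ext <;> simp [conj]

end Octonion

/-! ### The space `H₃(𝕆)` of Hermitian matrices over the complex octonions -/

/-- The element `((α₁, α₂, α₃), (a₁, a₂, a₃))` stands for `∑ α_j e_j + ∑ F_j(a_j)`, the Hermitian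
matrix `toMatrix` below. Indices are taken in `Fin 3`, so `i, i + 1, i + 2` is an even
permutation. -/
abbrev H3 : Type := (Fin 3 → ℂ) × (Fin 3 → Octonion ℂ)

namespace H3

open Octonion

/-- The matrix of an element of `H₃(𝕆)`. -/
noncomputable def toMatrix (a : H3) : Matrix (Fin 3) (Fin 3) (Octonion ℂ) :=
  !![scalar (a.1 0), a.2 2, star (a.2 1);
     star (a.2 2), scalar (a.1 1), a.2 0;
     a.2 1, star (a.2 0), scalar (a.1 2)]

theorem toMatrix_injective : Function.Injective toMatrix := by
  intro a b h
  have e : ∀ i j, toMatrix a i j = toMatrix b i j := fun i j => by rw [h]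
  have s : ∀ t u : ℂ, scalar t = scalar u → t = u := fun t u htu => by
    have := congrArg (fun z : Octonion ℂ => z.1.re) htu
    simpa using this
  refine Prod.ext (funext fun i => ?_) (funext fun i => ?_)
  · fin_cases i
    · exact s _ _ (e 0 0)
    · exact s _ _ (e 1 1)
    · exact s _ _ (e 2 2)
  · fin_cases i
    · exact e 1 2
    · exact e 2 0
    · exact e 0 1

theorem range_toMatrix : Set.range toMatrix = {M | M.IsHermitian} := by
  ext M
  constructor
  · rintro ⟨a, rfl⟩
    refine Matrix.ext fun i j => ?_
    have s : ∀ t : ℂ, star (scalar t : Octonion ℂ) = scalar t := fun t => by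
      ext <;> simp
    fin_cases i <;> fin_cases j <;>
      simp [toMatrix, Matrix.conjTranspose_apply, oct_star_star, s]
  · intro h
    have e : ∀ i j, star (M j i) = M i j := fun i j => by
      conv_rhs => rw [← show M.conjTranspose = M from h]
      rfl
    have s : ∀ z : Octonion ℂ, star z = z → scalar z.1.re = z := fun z hz => by
      have h1 := congrArg (fun z : Octonion ℂ => z.1) hz
      have h2 := congrArg (fun z : Octonion ℂ => z.2) hz
      simp only [star_fst, star_snd] at h1 h2
      rw [Quaternion.ext_iff] at h1 h2
      simp only [Quaternion.re_star, Quaternion.imI_star, Quaternion.imJ_star,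
        Quaternion.imK_star, Quaternion.re_neg, Quaternion.imI_neg, Quaternion.imJ_neg,
        Quaternion.imK_neg, neg_eq_self] at h1 h2
      ext : 1
      · ext <;> simp [h1]
      · exact Quaternion.ext_iff.2
          ⟨h2.1.symm, h2.2.1.symm, h2.2.2.1.symm, h2.2.2.2.symm⟩
    refine ⟨(fun i => (M i i).1.re, ![M 1 2, M 2 0, M 0 1]), ?_⟩
    refine Matrix.ext fun i j => ?_
    fin_cases i <;> fin_cases j <;> simp [toMatrix, e, s _ (e _ _)]

/-- The scalar product `(a : b) = ∑ α_j β_j + ∑ (a_j : b_j)`. -/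
noncomputable def inner (a b : H3) : ℂ :=
  ∑ j, a.1 j * b.1 j + ∑ j, Octonion.inner (a.2 j) (b.2 j)

/-- The adjoint
`a^# = ∑ (α_j α_k - n(a_i)) e_i + ∑ F_i((a_j a_k - α_i ã_i)~)`, `(i, j, k)` even. -/
noncomputable def adj (a : H3) : H3 :=
  (fun i => a.1 (i + 1) * a.1 (i + 2) - norm (a.2 i),
   fun i => star (a.2 (i + 1) * a.2 (i + 2) - a.1 i • star (a.2 i)))

/-- The Freudenthal product `a × b = (a + b)^# - a^# - b^#`. -/
noncomputable def cross (a b : H3) : H3 := adj (a + b) - adj a - adj b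

/-- The complex conjugation of `H₃(𝕆)` with respect to the real form `H₃(𝕆_c)`. -/
noncomputable def conj (a : H3) : H3 :=
  (fun i => starRingEnd ℂ (a.1 i), fun i => Octonion.conj (a.2 i))

/-- The Hermitian scalar product `(a | b) = (a : b̄)`. -/
noncomputable def herm (a b : H3) : ℂ := inner a (conj b)

theorem cross_eq (a b : H3) : cross a b =
    (fun i => a.1 (i + 1) * b.1 (i + 2) + a.1 (i + 2) * b.1 (i + 1)
        - Octonion.inner (a.2 i) (b.2 i),
     fun i => star (a.2 (i + 1) * b.2 (i + 2) + b.2 (i + 1) * a.2 (i + 2)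
        - a.1 i • star (b.2 i) - b.1 i • star (a.2 i))) := by
  refine Prod.ext (funext fun i => ?_) (funext fun i => ?_)
  · simp only [cross, adj, Octonion.inner, Prod.fst_add, Prod.snd_add, Prod.fst_sub,
      Pi.add_apply, Pi.sub_apply]
    ring
  · have hn : ∀ x y : Octonion ℂ, star (x - y) = star x - star y := fun x y => by
      ext : 1
      · simp
      · simp [sub_eq_add_neg, add_comm]
    simp only [cross, adj, Prod.fst_add, Prod.snd_add, Prod.snd_sub, Pi.add_apply, Pi.sub_apply,
      oct_add_mul, oct_mul_add, hn, oct_star_add, oct_star_smul, oct_star_star, add_smul, smul_add]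
    abel

theorem cross_comm (a b : H3) : cross a b = cross b a := by
  simp only [cross, add_comm a b]; abel

theorem cross_add (a b c : H3) : cross a (b + c) = cross a b + cross a c := by
  have hn : ∀ x y : Octonion ℂ, star (x - y) = star x - star y := fun x y => by
    ext : 1
    · simp
    · simp [sub_eq_add_neg, add_comm]
  simp only [cross_eq]
  refine Prod.ext (funext fun i => ?_) (funext fun i => ?_)
  · simp only [Octonion.inner_eq, Prod.fst_add, Prod.snd_add, Pi.add_apply, add_fst, add_snd,
      Quaternion.re_add, Quaternion.imI_add, Quaternion.imJ_add, Quaternion.imK_add]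
    ring
  · simp only [Prod.fst_add, Prod.snd_add, Pi.add_apply, oct_add_mul, oct_mul_add, hn, oct_star_add,
      oct_star_smul, oct_star_star, add_smul, smul_add]
    abel

theorem cross_smul (t : ℂ) (a b : H3) : cross a (t • b) = t • cross a b := by
  have hn : ∀ x y : Octonion ℂ, star (x - y) = star x - star y := fun x y => by
    ext : 1
    · simp
    · simp [sub_eq_add_neg, add_comm]
  simp only [cross_eq]
  refine Prod.ext (funext fun i => ?_) (funext fun i => ?_)
  · simp only [Octonion.inner_eq, Prod.smul_fst, Prod.smul_snd, Pi.smul_apply, smul_fst, smul_snd,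
      Quaternion.re_smul, Quaternion.imI_smul, Quaternion.imJ_smul, Quaternion.imK_smul,
      smul_eq_mul]
    ring
  · simp only [Prod.smul_fst, Prod.smul_snd, Pi.smul_apply, oct_smul_mul, oct_mul_smul, hn, oct_star_add,
      oct_star_smul, oct_star_star, smul_sub, smul_add, smul_eq_mul, mul_smul, smul_comm t]

theorem add_cross (a b c : H3) : cross (a + b) c = cross a c + cross b c := by
  rw [cross_comm, cross_add, cross_comm c a, cross_comm c b]

theorem smul_cross (t : ℂ) (a b : H3) : cross (t • a) b = t • cross a b := by
  rw [cross_comm, cross_smul, cross_comm b a]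

theorem conj_add (a b : H3) : conj (a + b) = conj a + conj b := by
  refine Prod.ext (funext fun i => ?_) (funext fun i => ?_)
  · simp [conj]
  · simp [conj, Octonion.conj_add]

theorem conj_smul (t : ℂ) (a : H3) : conj (t • a) = starRingEnd ℂ t • conj a := by
  refine Prod.ext (funext fun i => ?_) (funext fun i => ?_)
  · simp [conj]
  · simp [conj, Octonion.conj_smul]

theorem inner_comm (a b : H3) : inner a b = inner b a := by
  simp only [inner, Octonion.inner_eq, mul_comm]

theorem inner_add (a b c : H3) : inner a (b + c) = inner a b + inner a c := by
  simp only [inner, Octonion.inner_eq, Fin.sum_univ_three, Prod.fst_add, Prod.snd_add,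
    Pi.add_apply, add_fst, add_snd, Quaternion.re_add, Quaternion.imI_add, Quaternion.imJ_add,
    Quaternion.imK_add]
  ring

theorem inner_smul (t : ℂ) (a b : H3) : inner a (t • b) = t * inner a b := by
  simp only [inner, Octonion.inner_eq, Fin.sum_univ_three, Prod.smul_fst, Prod.smul_snd,
    Pi.smul_apply, smul_fst, smul_snd, Quaternion.re_smul, Quaternion.imI_smul,
    Quaternion.imJ_smul, Quaternion.imK_smul, smul_eq_mul]
  ring

theorem herm_add_left (a b c : H3) : herm (a + b) c = herm a c + herm b c := by
  simp only [herm, inner_comm _ (conj c), inner_add]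

theorem herm_smul_left (t : ℂ) (a b : H3) : herm (t • a) b = t * herm a b := by
  simp only [herm, inner_comm _ (conj b), inner_smul]

theorem herm_add_right (a b c : H3) : herm a (b + c) = herm a b + herm a c := by
  simp only [herm, conj_add, inner_add]

theorem herm_smul_right (t : ℂ) (a b : H3) : herm a (t • b) = starRingEnd ℂ t * herm a b := by
  simp only [herm, conj_smul, inner_smul]

/-- The triple product `{x y z} = (x | y) z + (z | y) x - (x × z) × ȳ` of `H₃(𝕆)`. -/
noncomputable def triple : HermitianJTS.TripleProduct H3 :=
  LinearMap.mk₂'ₛₗ (RingHom.id ℂ) (starRingEnd ℂ)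
    (fun x y =>
      { toFun := fun z => herm x y • z + herm z y • x - cross (cross x z) (conj y)
        map_add' := fun z w => by
          simp only [herm_add_left, cross_add, add_cross, add_smul, smul_add]
          abel
        map_smul' := fun t z => by
          simp only [herm_smul_left, cross_smul, smul_cross, RingHom.id_apply, smul_sub, smul_add,
            mul_smul, smul_comm t] })
    (fun x x' y => by
      refine LinearMap.ext fun z => ?_
      simp only [LinearMap.coe_mk, AddHom.coe_mk, LinearMap.add_apply, herm_add_left, add_cross,
        add_smul, smul_add]
      abel)
    (fun t x y => by
      refine LinearMap.ext fun z => ?_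
      simp only [LinearMap.coe_mk, AddHom.coe_mk, LinearMap.smul_apply, herm_smul_left, smul_cross,
        RingHom.id_apply, smul_sub, smul_add, mul_smul, smul_comm t])
    (fun x y y' => by
      refine LinearMap.ext fun z => ?_
      simp only [LinearMap.coe_mk, AddHom.coe_mk, LinearMap.add_apply, herm_add_right, conj_add,
        cross_add, add_smul]
      abel)
    (fun t x y => by
      refine LinearMap.ext fun z => ?_
      simp only [LinearMap.coe_mk, AddHom.coe_mk, LinearMap.smul_apply, herm_smul_right, conj_smul,
        cross_smul, smul_sub, smul_add, mul_smul])

theorem triple_apply (x y z : H3) :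
    triple x y z = herm x y • z + herm z y • x - cross (cross x z) (conj y) := rfl

end H3

/-! The triple product is that of a cubic norm structure, and nearly everything follows formally
from two facts: $(a\times b:c)$ is a symmetric trilinear form (`inner_cross`), and $a^{\#\#}=N(a)a$
(`adj_adj`). Both reduce to the composition algebra laws of $\mathbb O$, the second through the
middle Moufang identity. Linearizing $a^{\#\#}=N(a)a$ and transposing with respect to $(\,:\,)$
gives the identities behind `isHermitianJTS`; complex conjugation commutes with all operations, so
it only replaces $y$ by $\bar y$. Positivity is $\operatorname{Tr}D(x,y)=18\,(x\mid y)$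
(`trace_herm`). For simplicity, a nonzero ideal contains some $e_i$, hence all of them, hence $1$,
and $D(1,1)=2$; this last also gives tube type. The rank is at most $3$ because the span of $x$,
$x^{\#}\times\bar y$, $\bar y^{\#}$ is stable under $D(x,y)$.

Frames are handled without transitivity of an automorphism group, by identifying minimal tripotents
with the $v$ such that $v^{\#}=0$ and $(v\mid v)=1$. The hard direction
(`isRankOne_of_isMinimalTripotent`) is variational: maximize $\operatorname{Re}(x\mid v)$ over these
$v$. The first-order condition along a parabola in the cone $y^{\#}=0$ kills the component of $x$ in
$V_1(v)$, so $x=\lambda v+w$ with $w\in V_0(v)$. If $x$ is a minimal tripotent, then $|\lambda|=1$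
and $w=0$.

For such $v$, $D(v,v)=\mathrm{id}+(\,\cdot\mid v)v-P$ with $P$ the projection onto $V_0(v)$, and the
trace gives $\dim V_0(v)=27+1-18=10$. For orthogonal $v,w$ the space $V_0(v)\cap V_0(w)$ is the line
of $\overline{v\times w}$, itself of rank one. Hence frames have exactly three members and $b=0$;
and $V_{12}$ is the orthogonal complement of $c_1,c_2$ in $V_0(c_3)$, so $a=10-2=8$. -/

namespace Octonion

variable {k : Type*} [CommRing k]

-- Composition algebra identities for the octonions

attribute [simp] oct_star_star

theorem star_sub' (x y : Octonion k) : star (x - y) = star x - star y := by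
  ext : 1
  · simp
  · simp [sub_eq_add_neg, add_comm]

theorem oct_star_mul (x y : Octonion k) : star (x * y) = star y * star x := by
  ext <;> simp

theorem oct_sub_mul (x y z : Octonion k) : (x - y) * z = x * z - y * z := by
  ext : 1 <;> simp [sub_mul, mul_sub] <;> abel

theorem oct_mul_sub (x y z : Octonion k) : x * (y - z) = x * y - x * z := by
  ext : 1 <;> simp [sub_mul, mul_sub] <;> abel

@[simp] theorem oct_zero_mul (x : Octonion k) : 0 * x = 0 := by
  ext : 1 <;> simp

@[simp] theorem oct_mul_zero (x : Octonion k) : x * 0 = 0 := by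
  ext : 1 <;> simp

@[simp] theorem oct_star_zero : star (0 : Octonion k) = 0 := by
  ext : 1 <;> simp

@[simp] theorem norm_zero' : norm (0 : Octonion k) = 0 := by
  simp [norm]

theorem inner_self (x : Octonion k) : inner x x = 2 * norm x := by
  simp only [inner_eq, norm, Quaternion.normSq_def']; ring

theorem inner_comm (x y : Octonion k) : inner x y = inner y x := by
  simp only [inner_eq]; ring

theorem inner_sub_left (x y z : Octonion k) : inner (x - y) z = inner x z - inner y z := by
  simp [inner_eq]; ring

theorem inner_add_left (x y z : Octonion k) : inner (x + y) z = inner x z + inner y z := by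
  simp [inner_eq]; ring

theorem inner_smul_left (t : k) (x y : Octonion k) : inner (t • x) y = t * inner x y := by
  simp [inner_eq]; ring

theorem inner_smul_right (t : k) (x y : Octonion k) : inner x (t • y) = t * inner x y := by
  simp [inner_eq]; ring

@[simp] theorem inner_zero_right (x : Octonion k) : inner x 0 = 0 := by
  simpa using inner_smul_right 0 x 0

@[simp] theorem inner_zero_left (x : Octonion k) : inner 0 x = 0 := by
  simpa using inner_smul_left 0 0 x

@[simp] theorem oct_star_neg (x : Octonion k) : star (-x) = -star x := by
  ext <;> simp

@[simp] theorem inner_neg_left (x y : Octonion k) : inner (-x) y = -inner x y := by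
  simpa using inner_smul_left (-1) x y

theorem inner_star_star (x y : Octonion k) : inner (star x) (star y) = inner x y := by
  simp [inner_eq]

theorem norm_star' (x : Octonion k) : norm (star x) = norm x := by
  simp [norm, Quaternion.normSq_def']

theorem norm_smul' (t : k) (x : Octonion k) : norm (t • x) = t ^ 2 * norm x := by
  simp [norm, Quaternion.normSq_def']; ring

theorem norm_sub' (x y : Octonion k) : norm (x - y) = norm x - inner x y + norm y := by
  simp [inner_eq, norm, Quaternion.normSq_def']; ring

/-- The norm permits composition. -/
theorem norm_mul' (x y : Octonion k) : norm (x * y) = norm x * norm y := by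
  simp [norm, Quaternion.normSq_def']; ring

theorem mul_star_mul (x y : Octonion k) : x * (star x * y) = norm x • y := by
  ext <;> simp [norm, Quaternion.normSq_def'] <;> ring

theorem mul_mul_star (x y : Octonion k) : (x * star y) * y = norm y • x := by
  ext <;> simp [norm, Quaternion.normSq_def'] <;> ring

/-- The trace `t((x y) z)` is invariant under cyclic permutations. -/
theorem inner_star_mul (x y z : Octonion k) :
    inner (star (x * y)) z = inner (star (y * z)) x := by
  simp [inner_eq]; ring

/-- Polarization in $y$ of the alternative law `mul_mul_star`; it is the source of the Moufang
identity. -/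
theorem mul_mul_star_add (x y z : Octonion k) :
    (x * star y) * z + (x * star z) * y = inner y z • x := by
  have h := mul_mul_star x (y + z)
  have hn : norm (y + z) = norm y + norm z + inner y z := by simp only [inner]; ring
  simp only [oct_star_add, oct_mul_add, oct_add_mul, mul_mul_star, hn] at h
  linear_combination (norm := module) h

/-- The middle Moufang identity, with the product `x (y z) x` written out. -/
theorem moufang (x y z : Octonion k) :
    (x * y) * (z * x) = inner x (star (y * z)) • x - norm x • star (y * z) := by
  have h := mul_mul_star_add x (star y) (z * x)
  have hi : inner (star y) (z * x) = inner x (star (y * z)) := by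
    rw [← inner_star_star, oct_star_star, inner_comm, inner_star_mul, inner_star_mul, inner_comm]
  rw [oct_star_star, oct_star_mul z x, mul_star_mul, oct_smul_mul, ← oct_star_mul, hi] at h
  exact eq_sub_of_add_eq h

theorem conj_mul (x y : Octonion ℂ) : conj (x * y) = conj x * conj y := map_mul' _ x y

theorem conj_star (x : Octonion ℂ) : conj (star x) = star (conj x) := by
  ext <;> simp [conj]

theorem conj_sub (x y : Octonion ℂ) : conj (x - y) = conj x - conj y := by
  ext <;> simp [conj]

@[simp] theorem conj_zero : conj 0 = 0 := by
  simpa using conj_smul 0 0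

@[simp] theorem conj_conj (x : Octonion ℂ) : conj (conj x) = x := by
  ext <;> simp [conj]

theorem inner_conj (x y : Octonion ℂ) :
    inner (conj x) (conj y) = starRingEnd ℂ (inner x y) := by
  simp [inner_eq, conj, Complex.conj_ofNat]

/-- The coordinates of an octonion. -/
def coord (x : Octonion k) : Fin 8 → k :=
  ![x.1.re, x.1.imI, x.1.imJ, x.1.imK, x.2.re, x.2.imI, x.2.imJ, x.2.imK]

theorem inner_conj_self (x : Octonion ℂ) :
    inner x (conj x) = ((2 * ∑ i, Complex.normSq (coord x i) : ℝ) : ℂ) := by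
  simp [inner_eq, conj, Fin.sum_univ_eight, coord, ← Complex.mul_conj]

theorem coord_injective : Function.Injective (coord (k := k)) := by
  intro x y h
  have h' := fun i => congrFun h i
  ext
  exacts [h' 0, h' 1, h' 2, h' 3, h' 4, h' 5, h' 6, h' 7]

end Octonion

namespace H3

open Octonion

/-! ### The cubic form and the adjoint identities -/

/-- Both sides are the polarized cubic form. The off-diagonal terms are traces $t((xy)z)$, which the
rewrites rotate cyclically until the two sides agree. -/
theorem inner_cross (a b c : H3) : inner (cross a b) c = inner a (cross b c) := by
  simp only [inner, cross_eq, Fin.sum_univ_three, star_sub', oct_star_add, oct_star_smul,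
    oct_star_star, Octonion.inner_sub_left, Octonion.inner_add_left, Octonion.inner_smul_left,
    Octonion.inner_comm (a.2 _) (star _ + star _ - _ - _),
    Fin.isValue, Fin.reduceAdd, zero_add]
  rw [inner_star_mul (b.2 1) (c.2 2) (a.2 0), inner_star_mul (b.2 2) (c.2 0) (a.2 1),
    inner_star_mul (b.2 0) (c.2 1) (a.2 2), inner_star_mul (c.2 1) (b.2 2) (a.2 0),
    inner_star_mul (c.2 2) (b.2 0) (a.2 1), inner_star_mul (c.2 0) (b.2 1) (a.2 2),
    inner_star_mul (c.2 2) (a.2 0) (b.2 1), inner_star_mul (c.2 0) (a.2 1) (b.2 2),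
    inner_star_mul (c.2 1) (a.2 2) (b.2 0),
    inner_star_mul (b.2 2) (a.2 0) (c.2 1), inner_star_mul (b.2 0) (a.2 1) (c.2 2),
    inner_star_mul (b.2 1) (a.2 2) (c.2 0),
    Octonion.inner_comm (c.2 0) (a.2 0),
    Octonion.inner_comm (c.2 1) (a.2 1), Octonion.inner_comm (c.2 2) (a.2 2),
    Octonion.inner_comm (b.2 0) (a.2 0),
    Octonion.inner_comm (b.2 1) (a.2 1), Octonion.inner_comm (b.2 2) (a.2 2)]
  ring

theorem cross_self (a : H3) : cross a a = (2 : ℂ) • adj a := by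
  simp only [cross_eq, adj]
  refine Prod.ext (funext fun i => ?_) (funext fun i => ?_)
  · simp [Octonion.inner_self]; ring
  · simp only [Prod.smul_snd, Pi.smul_apply, star_sub', oct_star_add, oct_star_smul, oct_star_star]
    module

theorem adj_add (a b : H3) : adj (a + b) = adj a + adj b + cross a b := by
  simp only [cross]; abel

/-- The cubic form, normalized by `N(1) = 1`. -/
noncomputable def cubic (a : H3) : ℂ := (1 / 3) * inner (adj a) a

theorem inner_adj_self (a : H3) : inner (adj a) a = 3 * cubic a := by
  simp only [cubic]; ring

theorem sum_cyclic {M : Type*} [AddCommMonoid M] (f : Fin 3 → M) (i : Fin 3) :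
    ∑ j, f j = f i + f (i + 1) + f (i + 2) := by
  rw [Fin.sum_univ_three]
  fin_cases i
  · rfl
  · change f 0 + f 1 + f 2 = f 1 + f 2 + f 0
    abel
  · change f 0 + f 1 + f 2 = f 2 + f 0 + f 1
    abel

/-- The explicit cubic form is invariant under cyclic shifts of the indices. Centring it at an
arbitrary $i$ lets `adj_adj` treat all components at once. -/
theorem cubic_eq (a : H3) (i : Fin 3) :
    cubic a = a.1 i * a.1 (i + 1) * a.1 (i + 2) - ∑ j, a.1 j * norm (a.2 j)
      + Octonion.inner (star (a.2 (i + 1) * a.2 (i + 2))) (a.2 i) := by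
  have h : ∀ i, Octonion.inner (star (a.2 (i + 1) * a.2 (i + 2))) (a.2 i) =
      Octonion.inner (star (a.2 1 * a.2 2)) (a.2 0) := by
    intro i
    fin_cases i
    · rfl
    · exact (inner_star_mul _ _ _).symm
    · exact inner_star_mul _ _ _
  have h' : ∀ i, a.1 i * a.1 (i + 1) * a.1 (i + 2) = a.1 0 * a.1 1 * a.1 2 := by
    intro i
    fin_cases i
    · rfl
    · change a.1 1 * a.1 2 * a.1 0 = _
      ring
    · change a.1 2 * a.1 0 * a.1 1 = _
      ring
  rw [h, h']
  simp only [cubic, inner, adj, Fin.sum_univ_three, star_sub', oct_star_smul,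
    oct_star_star, Octonion.inner_sub_left, Octonion.inner_smul_left, Octonion.inner_self,
    h]
  simp only [Fin.isValue, Fin.reduceAdd, zero_add]
  ring

/-- The adjoint identity `a^## = N(a) a`. -/
theorem adj_adj (a : H3) : adj (adj a) = cubic a • a := by
  have e : ∀ i : Fin 3, i + 1 + 1 = i + 2 ∧ i + 1 + 2 = i ∧ i + 2 + 1 = i ∧ i + 2 + 2 = i + 1 := by
    decide
  refine Prod.ext (funext fun i => ?_) (funext fun i => ?_)
  · simp only [Prod.smul_fst, Pi.smul_apply, smul_eq_mul, cubic_eq a i, sum_cyclic _ i]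
    simp only [adj, e, norm_star', norm_sub', norm_mul', norm_smul', Octonion.inner_smul_right]
    rw [show Octonion.inner (a.2 (i + 1) * a.2 (i + 2)) (star (a.2 i)) = _ by
      rw [← inner_star_star, oct_star_star (a.2 i)]]
    ring
  -- With $j=i+1$, $k=i+2$, the product of the entries $j$ and $k$ of `adj a` contains $(\tilde
  -- a_i\tilde a_k)(\tilde a_j\tilde a_i)$, the Moufang pattern; the mixed terms collapse by
  -- alternativity (`l` and `r`).
  · have m := moufang (star (a.2 i)) (star (a.2 (i + 2))) (star (a.2 (i + 1)))
    have m' : Octonion.inner (star (a.2 i)) (a.2 (i + 1) * a.2 (i + 2)) =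
        Octonion.inner (star (a.2 (i + 1) * a.2 (i + 2))) (a.2 i) := by
      rw [← inner_star_star, oct_star_star, Octonion.inner_comm]
    rw [oct_star_mul (star (a.2 (i + 2))), oct_star_star, oct_star_star, m', norm_star'] at m
    have l := mul_star_mul (a.2 (i + 1)) (star (a.2 i))
    have r := mul_mul_star (star (a.2 i)) (a.2 (i + 2))
    simp only [Prod.smul_snd, Pi.smul_apply, cubic_eq a i, sum_cyclic _ i]
    simp only [adj, e, oct_star_star]
    refine Function.LeftInverse.injective oct_star_star ?_
    simp only [oct_star_star, oct_star_smul, star_sub', oct_sub_mul, oct_mul_sub, oct_smul_mul,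
      oct_mul_smul]
    rw [oct_star_mul (a.2 (i + 2)) (a.2 i), oct_star_mul (a.2 i) (a.2 (i + 1)), m, l, r]
    module

theorem add_inner (a b c : H3) : inner (a + b) c = inner a c + inner b c := by
  rw [inner_comm, inner_add, inner_comm c a, inner_comm c b]

theorem smul_inner (t : ℂ) (a b : H3) : inner (t • a) b = t * inner a b := by
  rw [inner_comm, inner_smul, inner_comm b a]

theorem sub_inner (a b c : H3) : inner (a - b) c = inner a c - inner b c := by
  rw [sub_eq_add_neg, ← neg_one_smul ℂ b, add_inner, smul_inner]; ring

theorem inner_sub (a b c : H3) : inner a (b - c) = inner a b - inner a c := by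
  rw [inner_comm, sub_inner, inner_comm b a, inner_comm c a]

theorem inner_zero (a : H3) : inner a 0 = 0 := by
  simpa using inner_smul 0 a 0

theorem zero_inner (a : H3) : inner 0 a = 0 := by
  rw [inner_comm, inner_zero]

theorem cross_sub (a b c : H3) : cross a (b - c) = cross a b - cross a c := by
  rw [sub_eq_add_neg, ← neg_one_smul ℂ c, cross_add, cross_smul]; module

theorem sub_cross (a b c : H3) : cross (a - b) c = cross a c - cross b c := by
  rw [cross_comm, cross_sub, cross_comm c a, cross_comm c b]

theorem cross_zero (a : H3) : cross a 0 = 0 := by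
  simpa using cross_smul 0 a 0

theorem zero_cross (a : H3) : cross 0 a = 0 := by
  rw [cross_comm, cross_zero]

theorem adj_smul (t : ℂ) (a : H3) : adj (t • a) = t ^ 2 • adj a := by
  have h := cross_self (t • a)
  rw [cross_smul, smul_cross, cross_self] at h
  linear_combination (norm := module) -(1 / 2 : ℂ) • h

theorem cubic_add (a b : H3) :
    cubic (a + b) = cubic a + inner (adj a) b + inner a (adj b) + cubic b := by
  have h1 : inner (cross a b) a = 2 * inner (adj a) b := by
    rw [cross_comm, inner_cross, cross_self, inner_smul, inner_comm]
  have h2 : inner (cross a b) b = 2 * inner a (adj b) := by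
    rw [inner_cross, cross_self, inner_smul]
  have h3 := inner_comm a (adj b)
  simp only [cubic, adj_add, add_inner, inner_add, h1, h2, h3]
  ring

theorem cubic_smul (t : ℂ) (a : H3) : cubic (t • a) = t ^ 3 * cubic a := by
  simp only [cubic, adj_smul, smul_inner, inner_smul]; ring

theorem adj_adj_add (a b : H3) (t : ℂ) :
    cubic a • a + t • cross (adj a) (cross a b)
      + t ^ 2 • (cross (adj a) (adj b) + adj (cross a b))
      + t ^ 3 • cross (adj b) (cross a b) + t ^ 4 • (cubic b • b) =
    (cubic a + t * inner (adj a) b + t ^ 2 * inner a (adj b) + t ^ 3 * cubic b) • (a + t • b) := by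
  have h := adj_adj (a + t • b)
  simp only [adj_add, adj_smul, cubic_add, cubic_smul, adj_adj, cross_smul, smul_cross, inner_smul,
    add_cross] at h
  linear_combination (norm := module) h

/-- The linearization of `a^## = N(a) a`. -/
theorem adj_cross_cross (a b : H3) :
    cross (adj a) (cross a b) = cubic a • b + inner (adj a) b • a := by
  have h1 := adj_adj_add a b 1
  have h2 := adj_adj_add a b (-1)
  have h3 := adj_adj_add a b 2
  have h4 := adj_adj_add a b (-2)
  -- Five-point central difference at $t=\pm1,\pm2$: it extracts the coefficient of $t$ exactly, the
  -- polynomials having degree at most four.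
  linear_combination (norm := module) (2 / 3 : ℂ) • h1 - (2 / 3 : ℂ) • h2 - (1 / 12 : ℂ) • h3
    + (1 / 12 : ℂ) • h4

theorem herm_self (a : H3) : herm a a =
    ((∑ i, Complex.normSq (a.1 i) + ∑ i, 2 * ∑ j, Complex.normSq (coord (a.2 i) j) : ℝ) : ℂ) := by
  simp [herm, inner, conj, inner_conj_self, Complex.mul_conj]

theorem herm_self_ofReal (a : H3) : herm a a = ((herm a a).re : ℂ) := by
  rw [herm_self, Complex.ofReal_re]

theorem herm_self_nonneg (a : H3) : 0 ≤ (herm a a).re := by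
  rw [herm_self, Complex.ofReal_re]
  exact add_nonneg (Finset.sum_nonneg fun i _ => Complex.normSq_nonneg _)
    (Finset.sum_nonneg fun i _ => mul_nonneg zero_le_two
      (Finset.sum_nonneg fun j _ => Complex.normSq_nonneg _))

theorem eq_zero_of_herm_self {a : H3} (h : herm a a = 0) : a = 0 := by
  rw [herm_self, Complex.ofReal_eq_zero] at h
  have h0 : ∀ i, 0 ≤ 2 * ∑ j, Complex.normSq (coord (a.2 i) j) := fun i =>
    mul_nonneg zero_le_two (Finset.sum_nonneg fun j _ => Complex.normSq_nonneg _)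
  rw [add_eq_zero_iff_of_nonneg (Finset.sum_nonneg fun i _ => Complex.normSq_nonneg _)
    (Finset.sum_nonneg fun i _ => h0 i), Finset.sum_eq_zero_iff_of_nonneg
    (fun i _ => Complex.normSq_nonneg _), Finset.sum_eq_zero_iff_of_nonneg (fun i _ => h0 i)] at h
  refine Prod.ext (funext fun i => ?_) (funext fun i => coord_injective (funext fun j => ?_))
  · simpa using h.1 i (Finset.mem_univ i)
  · have h2 := h.2 i (Finset.mem_univ i)
    rw [mul_eq_zero_iff_left two_ne_zero, Finset.sum_eq_zero_iff_of_nonneg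
      (fun i _ => Complex.normSq_nonneg _)] at h2
    rw [Complex.normSq_eq_zero.1 (h2 j (Finset.mem_univ j))]
    fin_cases j <;> rfl

theorem inner_left_injective {a b : H3} (h : ∀ c, inner a c = inner b c) : a = b := by
  refine sub_eq_zero.1 (eq_zero_of_herm_self ?_)
  rw [herm, sub_inner, h, sub_self]

/-- This is the transpose of `adj_cross_cross`: each operator $a\times\cdot$ is self-adjoint for the
nondegenerate form $(\,:\,)$. -/
theorem cross_adj_cross (a b : H3) :
    cross a (cross (adj a) b) = cubic a • b + inner a b • adj a := by
  refine inner_left_injective fun c => ?_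
  rw [cross_comm a, inner_cross, cross_comm _ b, inner_cross, adj_cross_cross]
  simp only [inner_add, add_inner, inner_smul, smul_inner, inner_comm b a]
  ring

theorem adj_cross_cross_add (a b c : H3) :
    cross (adj a) (cross b c) + cross (cross a b) (cross a c) =
      inner (adj a) b • c + inner (adj a) c • b + inner (cross a b) c • a := by
  have h1 := adj_cross_cross (a + b) c
  have h2 := adj_cross_cross (a - b) c
  have h3 := adj_cross_cross b c
  have e : a - b = a + (-1 : ℂ) • b := by module
  simp only [e, adj_add, adj_smul, add_cross, cross_add, cross_smul, smul_cross, add_inner,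
    smul_inner, cubic_add, cubic_smul, inner_smul] at h1 h2 h3
  -- Half the difference keeps the part odd in $b$, of degrees $1$ and $3$; `h3` is the degree $3$
  -- part.
  linear_combination (norm := module) (1 / 2 : ℂ) • h1 - (1 / 2 : ℂ) • h2 - h3

theorem cross_adj_cross_add (a b c : H3) :
    cross b (cross (adj a) c) + cross a (cross (cross a b) c) =
      inner (adj a) b • c + inner b c • adj a + inner a c • cross a b := by
  have h1 := cross_adj_cross (a + b) c
  have h2 := cross_adj_cross (a - b) c
  have h3 := cross_adj_cross b c
  have e : a - b = a + (-1 : ℂ) • b := by module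
  simp only [e, adj_add, adj_smul, add_cross, cross_add, cross_smul, smul_cross, add_inner,
    smul_inner, cubic_add, cubic_smul, inner_smul] at h1 h2 h3
  linear_combination (norm := module) (1 / 2 : ℂ) • h1 - (1 / 2 : ℂ) • h2 - h3

/-- The full linearization of `cross_adj_cross`. -/
theorem cross_cross_cross_add (a b c d : H3) :
    cross b (cross (cross a c) d) + cross c (cross (cross a b) d) + cross a (cross (cross c b) d) =
      inner (cross a c) b • d + inner b d • cross a c + inner c d • cross a b
        + inner a d • cross c b := by
  have h1 := cross_adj_cross_add (a + c) b d
  have h2 := cross_adj_cross_add a b d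
  have h3 := cross_adj_cross_add c b d
  simp only [adj_add, add_cross, cross_add, add_inner] at h1
  linear_combination (norm := module) h1 - h2 - h3

/-! ### The Jordan identities -/

theorem conj_conj (a : H3) : conj (conj a) = a := by
  refine Prod.ext (funext fun i => ?_) (funext fun i => ?_)
  · simp [conj]
  · simp [conj, Octonion.conj_conj]

theorem conj_cross (a b : H3) : conj (cross a b) = cross (conj a) (conj b) := by
  simp only [cross_eq]
  refine Prod.ext (funext fun i => ?_) (funext fun i => ?_)
  · simp [conj, Octonion.inner_conj]
  · simp [conj, conj_star, Octonion.conj_sub, Octonion.conj_add, Octonion.conj_smul, conj_mul]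

theorem conj_sub (a b : H3) : conj (a - b) = conj a - conj b := by
  rw [sub_eq_add_neg, ← neg_one_smul ℂ b, conj_add, conj_smul]
  simp [sub_eq_add_neg]

theorem conj_adj (a : H3) : conj (adj a) = adj (conj a) := by
  have h := congrArg conj (cross_self a)
  rw [conj_cross, cross_self, conj_smul, Complex.conj_ofNat] at h
  exact (smul_right_injective H3 (two_ne_zero' ℂ) h).symm

theorem inner_conj (a b : H3) : inner (conj a) (conj b) = starRingEnd ℂ (inner a b) := by
  simp [inner, conj, Octonion.inner_conj]

theorem Q_triple (x y : H3) :
    HermitianJTS.Q triple x y = inner x (conj y) • x - cross (adj x) (conj y) := by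
  rw [HermitianJTS.Q, triple_apply, cross_self, smul_cross, herm]
  module

theorem conj_Q_triple (x y : H3) :
    conj (HermitianJTS.Q triple x y) = inner (conj x) y • conj x - cross (adj (conj x)) y := by
  rw [Q_triple, conj_sub, conj_smul, conj_cross, ← inner_conj, conj_conj, conj_adj]

theorem isHermitianJTS : HermitianJTS.IsHermitianJTS triple where
  finiteDimensional := inferInstance
  symm x y z := by
    rw [triple_apply, triple_apply, cross_comm x z, add_comm (herm x y • z)]
  j1 x y u := by
    simp only [triple_apply, herm, Q_triple, conj_sub, conj_add, conj_smul, conj_cross, conj_conj,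
      ← inner_conj]
    -- From here on conjugation occurs only through $\bar y$ and $\bar u$, and the claim is a
    -- complex multilinear identity of the cubic structure.
    set y' := conj y
    set u' := conj u
    have h1 := cross_adj_cross x u'
    have h2 := adj_cross_cross x (cross y' u')
    have h3 : inner (cross (adj x) u') y' = inner (adj x) (cross y' u') := by
      rw [inner_cross, cross_comm u']
    have h4 : inner x (cross x (cross y' u')) = 2 * inner (adj x) (cross y' u') := by
      rw [← inner_cross, cross_self, smul_inner]
    simp only [sub_inner, inner_sub, inner_add, smul_inner, inner_smul, cross_sub, cross_add,
      cross_smul, add_cross, sub_cross, smul_cross, cross_self, h1, h3, h4,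
      cross_comm (cross y' u') x, h2, inner_comm y' x, inner_comm u' x,
      cross_comm u' y']
    module
  j2 x y z := by
    simp only [triple_apply, herm, conj_Q_triple]
    simp only [Q_triple]
    set y' := conj y
    have h1 := cross_adj_cross_add y' (adj x) z
    have h2 := adj_cross_cross_add x z (adj y')
    have h3 : inner (cross (adj x) y') y' = 2 * inner (adj x) (adj y') := by
      rw [inner_cross, cross_self, inner_smul]
    have h4 : inner x (cross (adj y') x) = 2 * inner (adj x) (adj y') := by
      rw [cross_comm, ← inner_cross, cross_self, smul_inner, inner_comm]
    have h5 : inner z (cross (adj y') x) = inner (cross x z) (adj y') := by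
      rw [cross_comm x z, inner_cross, cross_comm x]
    simp only [sub_inner, inner_sub, smul_inner, inner_smul, cross_sub, cross_smul, sub_cross,
      smul_cross, h3, h4, h5, inner_comm y' z, inner_comm y' x,
      inner_comm (adj y') (adj x)] at h1 ⊢
    rw [cross_comm (adj y') x]
    rw [cross_comm y' (adj x), cross_comm y' (cross (cross _ _) z), cross_comm (adj y') z] at h1
    linear_combination (norm := module) h1 - h2

end H3

/-! ### Traces in coordinates and positivity -/

namespace Octonion

variable {k : Type*} [CommRing k]

/-- The coordinates as a linear equivalence. -/
def coordEquiv : Octonion k ≃ₗ[k] (Fin 8 → k) where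
  toFun := coord
  map_add' x y := by
    funext i
    fin_cases i <;> rfl
  map_smul' t x := by
    funext i
    fin_cases i <;> rfl
  invFun f := (⟨f 0, f 1, f 2, f 3⟩, ⟨f 4, f 5, f 6, f 7⟩)
  left_inv x := rfl
  right_inv f := by
    funext i
    fin_cases i <;> rfl

/-- The standard basis `1, i, j, k, v, v i, v j, v k`. -/
noncomputable def basis : Module.Basis (Fin 8) k (Octonion k) := Module.Basis.ofEquivFun coordEquiv

theorem basis_repr (x : Octonion k) (i : Fin 8) : basis.repr x i = coord x i := rfl

theorem coord_basis (i j : Fin 8) : coord (basis i : Octonion k) j = if i = j then 1 else 0 := by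
  rw [← basis_repr, Module.Basis.repr_self, Finsupp.single_apply]

theorem basis_components (i : Fin 8) :
    (basis i : Octonion k).1.re = (if i = 0 then 1 else 0) ∧
    (basis i : Octonion k).1.imI = (if i = 1 then 1 else 0) ∧
    (basis i : Octonion k).1.imJ = (if i = 2 then 1 else 0) ∧
    (basis i : Octonion k).1.imK = (if i = 3 then 1 else 0) ∧
    (basis i : Octonion k).2.re = (if i = 4 then 1 else 0) ∧
    (basis i : Octonion k).2.imI = (if i = 5 then 1 else 0) ∧
    (basis i : Octonion k).2.imJ = (if i = 6 then 1 else 0) ∧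
    (basis i : Octonion k).2.imK = (if i = 7 then 1 else 0) :=
  ⟨coord_basis i 0, coord_basis i 1, coord_basis i 2, coord_basis i 3, coord_basis i 4,
    coord_basis i 5, coord_basis i 6, coord_basis i 7⟩

theorem coord_add (x y : Octonion k) : coord (x + y) = coord x + coord y := map_add coordEquiv x y

theorem coord_sub (x y : Octonion k) : coord (x - y) = coord x - coord y := map_sub coordEquiv x y

theorem sum_coord_smul (t : k) : ∑ j, coord (t • basis j : Octonion k) j = 8 * t := by
  simp [← basis_repr]

theorem sum_coord_inner (a b : Octonion k) :
    ∑ j, coord (inner a (basis j) • b) j = inner a b := by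
  simp [Fin.sum_univ_eight, coord, basis_components, inner_eq]
  ring

/-- The trace of $u\mapsto\tilde b(au)$. The constant can be read off at $a=b$, where the operator
is $n(a)\,\mathrm{id}$, of trace $8n(a)=4(a:a)$. -/
theorem sum_coord_left (a b : Octonion k) :
    ∑ j, coord (star (star (a * basis j) * b)) j = 4 * inner a b := by
  simp [Fin.sum_univ_eight, coord, basis_components, inner_eq]
  ring

theorem sum_coord_right (a b : Octonion k) :
    ∑ j, coord (star (b * star (basis j * a))) j = 4 * inner a b := by
  simp [Fin.sum_univ_eight, coord, basis_components, inner_eq]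
  ring

end Octonion

namespace H3

open Octonion

/-- The standard basis of `H₃(𝕆)`. -/
noncomputable def basis : Module.Basis (Fin 3 ⊕ (Σ _ : Fin 3, Fin 8)) ℂ H3 :=
  (Pi.basisFun ℂ (Fin 3)).prod (Pi.basis fun _ => Octonion.basis)

/-- The diagonal idempotents `e_i`. -/
noncomputable def idem (i : Fin 3) : H3 := (Pi.single i 1, 0)

/-- The off-diagonal elements `F_i(x)`. -/
noncomputable def off (i : Fin 3) (x : Octonion ℂ) : H3 := (0, Pi.single i x)

theorem trace_eq (f : H3 →ₗ[ℂ] H3) : LinearMap.trace ℂ H3 f =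
    ∑ i, (f (idem i)).1 i + ∑ i, ∑ j, coord ((f (off i (Octonion.basis j))).2 i) j := by
  rw [LinearMap.trace_eq_matrix_trace ℂ basis, Matrix.trace, Fintype.sum_sum_type,
    Fintype.sum_sigma]
  simp [LinearMap.toMatrix_apply, basis, idem, off, basis_repr]

theorem triple_idem_apply (x y : H3) (i : Fin 3) : (triple x y (idem i)).1 i =
    herm x y + (conj y).1 i * x.1 i - (x.1 (i + 1) * (conj y).1 (i + 1)
      + x.1 (i + 2) * (conj y).1 (i + 2) + Octonion.inner (x.2 i) ((conj y).2 i)) := by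
  rw [triple_apply, cross_eq, cross_eq, herm, herm]
  generalize conj y = y
  generalize inner x y = t
  fin_cases i <;>
    simp [idem, inner, Fin.sum_univ_three, oct_star_smul] <;> ring

theorem triple_off_apply (x y : H3) (i : Fin 3) (u : Octonion ℂ) : (triple x y (off i u)).2 i =
    herm x y • u + Octonion.inner ((conj y).2 i) u • x.2 i -
      (star (star (x.2 (i + 2) * u) * (conj y).2 (i + 2))
        + star ((conj y).2 (i + 1) * star (u * x.2 (i + 1)))
        + Octonion.inner (x.2 i) u • (conj y).2 i + (x.1 i * (conj y).1 i) • u) := by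
  rw [triple_apply, cross_eq, cross_eq, herm, herm]
  generalize conj y = y
  generalize inner x y = t
  rw [Octonion.inner_comm _ u]
  fin_cases i <;>
    simp [off, inner, Fin.sum_univ_three, star_sub', oct_star_add, oct_star_smul] <;> module

/-- The terms $(x\mid y)z$, $(z\mid y)x$ and $(x\times z)\times\bar y$, as operators in $z$, have
traces $27$, $1$ and $10$ times $(x\mid y)$, and $27+1-10=18$. -/
theorem trace_herm (x y : H3) :
    LinearMap.trace ℂ H3 (triple x y) = 18 * herm x y := by
  simp only [trace_eq, triple_idem_apply, triple_off_apply, coord_add, coord_sub, Pi.add_apply,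
    Pi.sub_apply, Finset.sum_add_distrib, Finset.sum_sub_distrib, sum_coord_smul, sum_coord_inner,
    sum_coord_left, sum_coord_right]
  simp only [herm, inner, Fin.sum_univ_three, Fin.isValue, Fin.reduceAdd, zero_add,
    Octonion.inner_comm ((conj y).2 _) (x.2 _)]
  ring

theorem herm_comm (x y : H3) : herm x y = starRingEnd ℂ (herm y x) := by
  rw [herm, herm, ← inner_conj, conj_conj, inner_comm]

theorem isPositive : HermitianJTS.IsPositive triple where
  hermitian x y := by
    rw [trace_herm, trace_herm, herm_comm x y]
    simp [Complex.conj_ofNat]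
  pos x hx := by
    rw [trace_herm, herm_self_ofReal]
    have h : (herm x x).re ≠ 0 := fun h => hx (eq_zero_of_herm_self (by
      rw [herm_self_ofReal, h, Complex.ofReal_zero]))
    have := (herm_self_nonneg x).lt_of_ne h.symm
    simpa using this

/-! ### Simplicity and tube type -/

theorem triple_idem (i : Fin 3) (z : H3) : triple (idem i) (idem i) z =
    (Pi.single i (2 * z.1 i), z.2 - Pi.single i (z.2 i)) := by
  rw [triple_apply, cross_eq, cross_eq]
  fin_cases i <;> refine Prod.ext (funext fun j => ?_) (funext fun j => ?_) <;> fin_cases j <;>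
    simp [idem, herm, inner, conj, Fin.sum_univ_three, oct_star_smul]
  all_goals ring

theorem triple_one (z : H3) : triple (1, 0) (1, 0) z = (2 : ℂ) • z := by
  rw [triple_apply, cross_eq, cross_eq]
  refine Prod.ext (funext fun j => ?_) (funext fun j => ?_) <;> fin_cases j <;>
    simp [herm, inner, conj, Fin.sum_univ_three]
  all_goals first | ring1 | module

theorem triple_off_off_idem (i : Fin 3) (x : Octonion ℂ) : triple (off i x) (off i x) (idem (i + 1)) =
    Octonion.inner x (Octonion.conj x) • idem (i + 1) := by
  rw [triple_apply, cross_eq, cross_eq]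
  fin_cases i <;> refine Prod.ext (funext fun j => ?_) (funext fun j => ?_) <;> fin_cases j <;>
    simp [idem, off, herm, inner, conj, Fin.sum_univ_three, oct_star_smul]

/-- Only the $F_i$ component has nonzero eigenvalues for both $D(e_{i+1},e_{i+1})$ and
$D(e_{i+2},e_{i+2})$, and both are $1$; so ideals are closed under taking this component. -/
theorem off_eq (x : H3) (i : Fin 3) : triple (idem (i + 1)) (idem (i + 1))
    (triple (idem (i + 2)) (idem (i + 2)) x) = off i (x.2 i) := by
  simp only [triple_idem]
  fin_cases i <;> refine Prod.ext (funext fun j => ?_) (funext fun j => ?_) <;> fin_cases j <;>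
    simp [off]

theorem triple_idem_idem (x : H3) (i : Fin 3) : triple (idem i) x (idem i) =
    (2 * starRingEnd ℂ (x.1 i)) • idem i := by
  rw [triple_apply, cross_eq, cross_eq]
  fin_cases i <;> refine Prod.ext (funext fun j => ?_) (funext fun j => ?_) <;> fin_cases j <;>
    simp [idem, herm, inner, conj, Fin.sum_univ_three]
  all_goals ring

theorem triple_idem_off (i : Fin 3) (a : Octonion ℂ) :
    triple (idem i) (idem i) (off (i + 1) a) = off (i + 1) a := by
  rw [triple_idem]
  fin_cases i <;> refine Prod.ext (funext fun j => ?_) (funext fun j => ?_) <;> fin_cases j <;>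
    simp [off]

theorem inner_conj_ne_zero {x : Octonion ℂ} (hx : x ≠ 0) :
    Octonion.inner x (Octonion.conj x) ≠ 0 := by
  intro h
  have h' : herm (off 0 x) (off 0 x) = 0 := by
    simpa [herm, inner, conj, off, Fin.sum_univ_three] using h
  have := congrArg (fun z : H3 => z.2 0) (eq_zero_of_herm_self h')
  exact hx (by simpa [off] using this)

theorem idem_mem_of_off_mem {I : Submodule ℂ H3} (hI : HermitianJTS.IsIdeal triple I) {i : Fin 3}
    {x : Octonion ℂ} (hx : x ≠ 0) (h : off i x ∈ I) : idem (i + 1) ∈ I := by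
  have := (hI _ h (off i x) (idem (i + 1))).1
  rw [triple_off_off_idem] at this
  exact (Submodule.smul_mem_iff _ (inner_conj_ne_zero hx)).1 this

/-- The ideal passes from $e_i$ to $F_{i+1}(1)\in V_1(e_i)$ and from there to $e_{i+2}$; iterating
reaches all three idempotents. -/
theorem idem_mem_of_idem_mem {I : Submodule ℂ H3} (hI : HermitianJTS.IsIdeal triple I) {i : Fin 3}
    (h : idem i ∈ I) : idem (i + 2) ∈ I := by
  have h1 := (hI _ h (idem i) (off (i + 1) (scalar 1))).1
  rw [triple_idem_off] at h1
  have h0 : (scalar 1 : Octonion ℂ) ≠ 0 := fun h => by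
    have := congrArg (fun z : Octonion ℂ => z.1.re) h
    exact one_ne_zero (α := ℂ) this
  have := idem_mem_of_off_mem hI h0 h1
  rwa [add_assoc] at this

theorem one_eq : ((1, 0) : H3) = idem 0 + idem 1 + idem 2 := by
  refine Prod.ext (funext fun j => ?_) ?_
  · fin_cases j <;> simp [idem]
  · simp [idem]

theorem isSimple : HermitianJTS.IsSimple triple := by
  constructor
  · intro h
    have := congrArg (fun z : H3 => z.1 0) (triple_one (1, 0))
    simp [h] at this
  · intro I hI
    refine or_iff_not_imp_left.2 fun hne => ?_
    obtain ⟨x, hx, hx0⟩ := Submodule.exists_mem_ne_zero_of_ne_bot hne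
    have h1 : ∃ i, idem i ∈ I := by
      by_cases hd : ∃ i, x.1 i ≠ 0
      · obtain ⟨i, hi⟩ := hd
        have := (hI x hx (idem i) (idem i)).2.1
        rw [triple_idem_idem] at this
        exact ⟨i, (Submodule.smul_mem_iff _ (by simpa using hi)).1 this⟩
      · by_cases ho : ∃ i, x.2 i ≠ 0
        · obtain ⟨i, hi⟩ := ho
          have := (hI _ (hI x hx (idem (i + 2)) (idem (i + 2))).2.2 (idem (i + 1))
            (idem (i + 1))).2.2
          rw [off_eq] at this
          exact ⟨i + 1, idem_mem_of_off_mem hI hi this⟩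
        · push Not at hd ho
          exact absurd (Prod.ext (funext hd) (funext ho)) hx0
    obtain ⟨i, hi⟩ := h1
    have hi2 := idem_mem_of_idem_mem hI hi
    have hi1 := idem_mem_of_idem_mem hI hi2
    have hall : ∀ j, idem j ∈ I := by
      intro j
      fin_cases i <;> fin_cases j <;> assumption
    have hone : ((1, 0) : H3) ∈ I := by
      rw [one_eq]
      exact I.add_mem (I.add_mem (hall 0) (hall 1)) (hall 2)
    refine (Submodule.eq_top_iff' (p := I)).2 fun z => ?_
    have := (hI _ hone (1, 0) z).1
    rw [triple_one] at this
    exact (Submodule.smul_mem_iff _ two_ne_zero).1 this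

theorem isTubeType : HermitianJTS.IsTubeType triple := by
  refine ⟨(1, 0), ?_, ?_⟩
  · rw [HermitianJTS.IsTripotent, HermitianJTS.Q, triple_one, smul_smul]
    norm_num
  · refine (Submodule.eq_top_iff').2 fun z => ?_
    rw [HermitianJTS.peirce, Module.End.mem_eigenspace_iff, triple_one]
    norm_num

/-! ### The rank -/

theorem triple_self (x y : H3) :
    triple x y x = (2 : ℂ) • (inner x (conj y) • x - cross (adj x) (conj y)) := by
  rw [← Q_triple, HermitianJTS.Q, smul_smul]
  norm_num

theorem triple_adj_cross (x y : H3) : triple x y (cross (adj x) (conj y)) =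
    (2 * inner (adj x) (adj (conj y))) • x - (2 * cubic x) • adj (conj y) := by
  rw [triple_apply, herm, herm, inner_cross, cross_self, cross_adj_cross, add_cross, smul_cross,
    smul_cross, cross_self, inner_smul]
  module

theorem triple_adj_conj (x y : H3) : triple x y (adj (conj y)) = (2 * cubic (conj y)) • x := by
  rw [triple_apply, herm, herm, inner_adj_self, cross_comm x, cross_comm _ (conj y),
    cross_adj_cross, inner_comm]
  module

theorem minpolyDegree_le (x y : H3) : HermitianJTS.minpolyDegree triple x y ≤ 3 := by
  -- These three vectors span a $D(x,y)$-stable space containing $x$, hence all powers of $x$ in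
  -- $V^{(y)}$.
  let v : Fin 3 → H3 := ![x, cross (adj x) (conj y), adj (conj y)]
  have h0 : x ∈ Submodule.span ℂ (Set.range v) := Submodule.subset_span ⟨0, rfl⟩
  have h1 : cross (adj x) (conj y) ∈ Submodule.span ℂ (Set.range v) :=
    Submodule.subset_span ⟨1, rfl⟩
  have h2 : adj (conj y) ∈ Submodule.span ℂ (Set.range v) := Submodule.subset_span ⟨2, rfl⟩
  have hD : Submodule.span ℂ (Set.range v) ≤
      (Submodule.span ℂ (Set.range v)).comap (triple x y) := by
    have g0 : triple x y x ∈ Submodule.span ℂ (Set.range v) := by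
      rw [triple_self]
      exact Submodule.smul_mem _ _ (Submodule.sub_mem _ (Submodule.smul_mem _ _ h0) h1)
    have g1 : triple x y (cross (adj x) (conj y)) ∈ Submodule.span ℂ (Set.range v) := by
      rw [triple_adj_cross]
      exact Submodule.sub_mem _ (Submodule.smul_mem _ _ h0) (Submodule.smul_mem _ _ h2)
    have g2 : triple x y (adj (conj y)) ∈ Submodule.span ℂ (Set.range v) := by
      rw [triple_adj_conj]
      exact Submodule.smul_mem _ _ h0
    refine Submodule.span_le.2 ?_
    rintro _ ⟨i, rfl⟩
    fin_cases i
    exacts [g0, g1, g2]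
  have hp : ∀ k, HermitianJTS.power triple x y k ∈ Submodule.span ℂ (Set.range v) := by
    intro k
    induction k with
    | zero => exact h0
    | succ k ih => exact Submodule.smul_mem _ _ (hD ih)
  calc HermitianJTS.minpolyDegree triple x y
      ≤ Module.finrank ℂ (Submodule.span ℂ (Set.range v)) :=
        Submodule.finrank_mono (Submodule.span_le.2 (by rintro _ ⟨k, rfl⟩; exact hp k))
    _ ≤ 3 := by
      have := finrank_range_le_card (R := ℂ) v
      rwa [Fintype.card_fin] at this

theorem triple_diag (a b : Fin 3 → ℂ) : triple (a, 0) (1, 0) (b, 0) = (2 : ℂ) • (a * b, 0) := by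
  rw [triple_apply, cross_eq, cross_eq]
  refine Prod.ext (funext fun j => ?_) (funext fun j => ?_) <;> fin_cases j <;>
    simp [herm, inner, conj, Fin.sum_univ_three]
  all_goals ring

theorem hasRank : HermitianJTS.HasRank triple 3 := by
  -- With $y=1$, diagonal elements multiply entrywise; three distinct nonzero entries give a
  -- Vandermonde system of size three.
  refine ⟨⟨(![1, 2, 3], 0), (1, 0), le_antisymm (minpolyDegree_le _ _) ?_⟩, ?_⟩
  · have hp : ∀ k, HermitianJTS.power triple (![1, 2, 3], 0) (1, 0) k =
        (![1, 2, 3] ^ (k + 1), 0) := by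
      intro k
      induction k with
      | zero => simp [HermitianJTS.power]
      | succ k ih =>
        rw [HermitianJTS.power, ih, triple_diag, smul_smul, pow_succ' _ (k + 1)]
        norm_num
    have hli : LinearIndependent ℂ
        (fun k : Fin 3 => HermitianJTS.power triple (![1, 2, 3], 0) (1, 0) k) := by
      rw [Fintype.linearIndependent_iff]
      intro g hg
      simp only [hp, Fin.sum_univ_three] at hg
      have e : ∀ i, g 0 * (![1, 2, 3] : Fin 3 → ℂ) i ^ (0 + 1) +
          g 1 * (![1, 2, 3] : Fin 3 → ℂ) i ^ (1 + 1) + g 2 * (![1, 2, 3] : Fin 3 → ℂ) i ^ (2 + 1) = 0 :=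
        fun i => congrFun (congrArg Prod.fst hg) i
      have e0 := e 0
      have e1 := e 1
      have e2 := e 2
      simp only [Matrix.cons_val] at e0 e1 e2
      intro i
      fin_cases i <;> simp only [Fin.zero_eta, Fin.mk_one, Fin.reduceFinMk]
      -- The coefficients in these three lines are the rows of the inverse of the matrix
      -- $(i^k)_{1\le i,k\le3}$.
      · linear_combination 3 * e0 - (3 / 2) * e1 + (1 / 3) * e2
      · linear_combination (-5 / 2) * e0 + 2 * e1 - (1 / 2) * e2
      · linear_combination (1 / 2) * e0 - (1 / 2) * e1 + (1 / 6) * e2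
    have := finrank_span_eq_card hli
    rw [Fintype.card_fin] at this
    refine this.symm.le.trans ?_
    refine Submodule.finrank_mono (Submodule.span_mono ?_)
    rintro _ ⟨k, rfl⟩
    exact ⟨k, rfl⟩
  · rintro _ ⟨x, y, rfl⟩
    exact minpolyDegree_le x y

/-! ### Elements of rank one -/

theorem herm_triple (x y z w : H3) : herm (triple x y z) w = herm z (triple y x w) := by
  have h : inner (cross (cross x z) (conj y)) (conj w) =
      inner z (cross (cross (conj y) (conj w)) x) := by
    rw [inner_cross, cross_comm x, inner_cross, cross_comm x]
  simp only [triple_apply, herm, conj_sub, conj_add, conj_smul, conj_cross, conj_conj, ← inner_conj,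
    inner_add, inner_sub, add_inner, sub_inner, inner_smul, smul_inner, h]
  rw [inner_comm (conj y) x, inner_comm (conj w) x]
  ring

theorem triple_comm (x y z : H3) : triple x y z = triple z y x := isHermitianJTS.symm x y z

/-- Orthogonality is symmetric. -/
theorem triple_eq_zero_symm {x y : H3} (h : triple x y = 0) : triple y x = 0 := by
  refine LinearMap.ext fun z => eq_zero_of_herm_self ?_
  rw [herm_triple, h, LinearMap.zero_apply, herm, ← zero_smul ℂ (0 : H3), conj_smul, map_zero,
    zero_smul, inner_zero]

theorem herm_zero_right (x : H3) : herm x 0 = 0 := by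
  simpa using herm_smul_right 0 x 0

theorem herm_zero_left (x : H3) : herm 0 x = 0 := by
  simpa using herm_smul_left 0 0 x

theorem herm_sub_left (a b c : H3) : herm (a - b) c = herm a c - herm b c := by
  simp only [herm, sub_inner]

theorem herm_sub_right (a b c : H3) : herm a (b - c) = herm a b - herm a c := by
  simp only [herm, conj_sub, inner_sub]

/-- Elements `v` with `v^# = 0` and `(v | v) = 1`. -/
structure IsRankOne (v : H3) : Prop where
  adj_eq : adj v = 0
  herm_eq : herm v v = 1

namespace IsRankOne

variable {v w : H3}

theorem ne_zero (hv : IsRankOne v) : v ≠ 0 := by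
  rintro rfl
  simpa [herm_zero_left] using hv.herm_eq

theorem smul (hv : IsRankOne v) {t : ℂ} (ht : t * starRingEnd ℂ t = 1) : IsRankOne (t • v) :=
  ⟨by rw [adj_smul, hv.adj_eq, smul_zero],
    by rw [herm_smul_left, herm_smul_right, hv.herm_eq, mul_one, ht]⟩

theorem adj_conj_eq (hv : IsRankOne v) : adj (conj v) = 0 := by
  rw [← conj_adj, hv.adj_eq, ← zero_smul ℂ (0 : H3), conj_smul, map_zero, zero_smul, zero_smul]

/-- When $v^{\#}=0$ the linearized identities lose most terms. This one makes `projZero` idempotent;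
`cross_cross` yields `adj_cross`, by which $v\times\cdot$ preserves the cone $y^{\#}=0$. -/
theorem cross_cross_cross (hv : adj v = 0) (z u : H3) :
    cross v (cross (cross v z) u) = inner v u • cross v z := by
  have h := cross_adj_cross_add v z u
  simpa [hv, zero_cross, cross_zero, zero_inner] using h

theorem cross_cross (hv : adj v = 0) (z u : H3) :
    cross (cross v z) (cross v u) = inner (cross v z) u • v := by
  have h := adj_cross_cross_add v z u
  simpa [hv, zero_cross, cross_zero, zero_inner] using h

theorem adj_cross (hv : adj v = 0) (z : H3) : adj (cross v z) = inner v (adj z) • v := by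
  have h := cross_cross hv z z
  rw [cross_self, inner_cross, cross_self, inner_smul, mul_smul] at h
  exact smul_right_injective H3 (two_ne_zero' ℂ) h

end IsRankOne

/-- The projection onto the Peirce space `V_0(v)` of an element `v` of rank one. -/
noncomputable def projZero (v : H3) : H3 →ₗ[ℂ] H3 where
  toFun z := cross (cross v z) (conj v)
  map_add' z w := by rw [cross_add, add_cross]
  map_smul' t z := by rw [cross_smul, smul_cross, RingHom.id_apply]

theorem projZero_apply (v z : H3) : projZero v z = cross (cross v z) (conj v) := rfl

theorem herm_projZero (v z w : H3) : herm (projZero v z) w = herm z (projZero v w) := by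
  rw [herm, herm, projZero_apply, projZero_apply, conj_cross, conj_cross, conj_conj, inner_cross,
    cross_comm v, inner_cross, cross_comm v]

namespace IsRankOne

variable {v w : H3}

theorem cross_projZero (hv : IsRankOne v) (z : H3) : cross v (projZero v z) = cross v z := by
  rw [projZero_apply, cross_cross_cross hv.adj_eq, show inner v (H3.conj v) = 1 from hv.herm_eq,
    one_smul]

theorem projZero_projZero (hv : IsRankOne v) (z : H3) :
    projZero v (projZero v z) = projZero v z := by
  rw [projZero_apply, hv.cross_projZero, projZero_apply]

theorem projZero_self (hv : IsRankOne v) : projZero v v = 0 := by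
  rw [projZero_apply, cross_self, hv.adj_eq, smul_zero, zero_cross]

theorem herm_projZero_self (hv : IsRankOne v) (z : H3) : herm (projZero v z) v = 0 := by
  rw [herm_projZero, hv.projZero_self, herm_zero_right]

/-- The Peirce decomposition of $v$ in one formula: $D(v,v)$ is $2$ on $\mathbb Cv$, $0$ on the
range of `projZero v`, and $1$ on the common kernel of $(\,\cdot\mid v)$ and `projZero v`. -/
theorem triple_self_apply (hv : IsRankOne v) (z : H3) :
    triple v v z = z + herm z v • v - projZero v z := by
  rw [triple_apply, hv.herm_eq, one_smul, projZero_apply]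

theorem triple_self_self (hv : IsRankOne v) : triple v v v = (2 : ℂ) • v := by
  rw [hv.triple_self_apply, hv.projZero_self, hv.herm_eq]
  module

theorem triple_self_eq_zero_iff (hv : IsRankOne v) {z : H3} :
    triple v v z = 0 ↔ projZero v z = z := by
  rw [hv.triple_self_apply]
  constructor
  · intro h
    have h' := congrArg (fun a => herm a v) h
    simp only [herm_sub_left, herm_add_left, herm_smul_left, hv.herm_eq, hv.herm_projZero_self,
      herm_zero_left] at h'
    have h0 : herm z v = 0 := by linear_combination (1 / 2 : ℂ) * h'
    rw [h0] at h
    linear_combination (norm := module) -(1 : ℂ) • h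
  · intro h
    have h0 : herm z v = 0 := by rw [← h, hv.herm_projZero_self]
    rw [h, h0]
    module

/-- For `v` of rank one, orthogonality to `v` means lying in `V_0(v)`. -/
theorem triple_eq_zero_iff (hv : IsRankOne v) {w : H3} :
    triple v w = 0 ↔ projZero v w = w := by
  constructor
  · intro h
    rw [← hv.triple_self_eq_zero_iff, triple_comm, triple_eq_zero_symm h, LinearMap.zero_apply]
  · intro h
    refine LinearMap.ext fun z => ?_
    have h0 : herm v w = 0 := by
      rw [herm_comm, ← h, hv.herm_projZero_self, map_zero]
    have h1 : H3.conj w = cross v (H3.conj (cross v w)) := by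
      conv_lhs => rw [← h, projZero_apply, conj_cross, conj_conj, cross_comm]
    rw [triple_apply, h0, herm, h1, cross_cross hv.adj_eq, cross_comm v z, inner_cross]
    simp

theorem trace_projZero (hv : IsRankOne v) : LinearMap.trace ℂ H3 (projZero v) = 10 := by
  let f : H3 →ₗ[ℂ] ℂ :=
    { toFun := fun z => herm z v
      map_add' := fun a b => herm_add_left a b v
      map_smul' := fun t a => herm_smul_left t a v }
  have h : triple v v = LinearMap.id + f.smulRight v - projZero v :=
    LinearMap.ext fun z => hv.triple_self_apply z
  have h27 : Module.finrank ℂ H3 = 27 := by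
    rw [Module.finrank_eq_card_basis basis]
    simp
  have ht := trace_herm v v
  rw [hv.herm_eq, h, map_sub, map_add, LinearMap.trace_smulRight, LinearMap.trace_id, h27,
    show f v = 1 from hv.herm_eq] at ht
  push_cast at ht
  linear_combination -ht

theorem finrank_range_projZero (hv : IsRankOne v) :
    Module.finrank ℂ (LinearMap.range (projZero v)) = 10 := by
  have hp : LinearMap.IsProj (LinearMap.range (projZero v)) (projZero v) :=
    ⟨fun z => ⟨z, rfl⟩, by rintro _ ⟨z, rfl⟩; exact hv.projZero_projZero z⟩
  have := hp.trace
  rw [hv.trace_projZero] at this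
  exact_mod_cast this.symm

theorem mem_range_projZero (hv : IsRankOne v) {z : H3} :
    z ∈ LinearMap.range (projZero v) ↔ projZero v z = z :=
  ⟨by rintro ⟨z, rfl⟩; exact hv.projZero_projZero z, fun h => ⟨z, h⟩⟩

theorem Q_apply (hv : IsRankOne v) (z : H3) : HermitianJTS.Q triple v z = herm v z • v := by
  rw [Q_triple, hv.adj_eq, zero_cross, sub_zero, herm]

theorem isTripotent (hv : IsRankOne v) : HermitianJTS.IsTripotent triple v := by
  rw [HermitianJTS.IsTripotent, hv.Q_apply, hv.herm_eq, one_smul]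

theorem Q_add_of_orthogonal {u w : H3} (h : triple u w = 0) :
    HermitianJTS.Q triple (u + w) u = HermitianJTS.Q triple u u := by
  have h' := triple_eq_zero_symm h
  simp only [HermitianJTS.Q, map_add, LinearMap.add_apply, h', LinearMap.zero_apply, add_zero,
    triple_comm u u w]

/-- $Q(v)$ takes values in $\mathbb Cv$. If $v=u+w$ with $u,w$ orthogonal, then $u=Q(u)u=Q(v)u$ and
likewise for $w$, so both are multiples of $v$; nonzero multiples are not orthogonal, as
$D(v,v)v=2v$. -/
theorem isMinimalTripotent (hv : IsRankOne v) : HermitianJTS.IsMinimalTripotent triple v := by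
  refine ⟨hv.isTripotent, hv.ne_zero, fun u w hu hw huw hvuw => ?_⟩
  have h1 : u = herm v u • v := by
    have h := Q_add_of_orthogonal huw
    rw [← hvuw, hv.Q_apply, show HermitianJTS.Q triple u u = u from hu] at h
    exact h.symm
  have h2 : w = herm v w • v := by
    have h := Q_add_of_orthogonal (triple_eq_zero_symm huw)
    rw [add_comm, ← hvuw, hv.Q_apply, show HermitianJTS.Q triple w w = w from hw] at h
    exact h.symm
  by_contra! hne
  have h3 : triple u w v = 0 := by
    rw [show triple u w = 0 from huw, LinearMap.zero_apply]
  rw [h1, h2, LinearMap.map_smulₛₗ, LinearMap.map_smul, LinearMap.smul_apply, LinearMap.smul_apply,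
    LinearMap.smul_apply,
    hv.triple_self_self] at h3
  have hu0 : herm v u ≠ 0 := fun h => hne.1 (by rw [h1, h, zero_smul])
  have hw0 : herm v w ≠ 0 := fun h => hne.2 (by rw [h2, h, zero_smul])
  simp [hv.ne_zero, hu0, hw0] at h3

end IsRankOne

theorem isRankOne_idem (i : Fin 3) : IsRankOne (idem i) := by
  constructor
  · fin_cases i <;> refine Prod.ext (funext fun j => ?_) (funext fun j => ?_) <;> fin_cases j <;>
      simp [idem, adj]
  · fin_cases i <;> simp [idem, herm, inner, conj, Fin.sum_univ_three]

/-! ### Minimal tripotents have rank one -/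

/-- The Hermitian scalar product as an inner product, antilinear in the first variable. -/
@[reducible] noncomputable def hermCore : InnerProductSpace.Core ℂ H3 where
  inner x y := herm y x
  conj_inner_symm x y := (herm_comm y x).symm
  re_inner_nonneg x := herm_self_nonneg x
  add_left x y z := herm_add_right z x y
  smul_left x y t := herm_smul_right t y x
  definite _ h := eq_zero_of_herm_self h

/-- The Freudenthal product as a bilinear map. -/
noncomputable def crossₗ : H3 →ₗ[ℂ] H3 →ₗ[ℂ] H3 :=
  LinearMap.mk₂ ℂ cross add_cross smul_cross cross_add cross_smul

theorem exists_isRankOne_max (x : H3) :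
    ∃ v, IsRankOne v ∧ ∀ w, IsRankOne w → (herm x w).re ≤ (herm x v).re := by
  let _ : NormedAddCommGroup H3 := hermCore.toNormedAddCommGroup
  let _ : InnerProductSpace ℂ H3 := InnerProductSpace.ofCore hermCore.toCore
  have _ : ProperSpace H3 := FiniteDimensional.proper ℂ H3
  have hh : ∀ a b : H3, herm a b = Inner.inner ℂ b a := fun _ _ => rfl
  have hc : Continuous fun v : H3 => cross v v := by
    have h1 : Continuous fun v : H3 => LinearMap.toContinuousLinearMap (crossₗ v) :=
      (LinearMap.toContinuousLinearMap.toLinearMap ∘ₗ crossₗ).continuous_of_finiteDimensional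
    exact h1.clm_apply continuous_id
  have hset : {v : H3 | IsRankOne v} = {v | cross v v = 0} ∩ Metric.sphere 0 1 := by
    ext v
    have hn : herm v v = 1 ↔ ‖v‖ = 1 := by
      have hr : (herm v v).re = ‖v‖ ^ 2 := (norm_sq_eq_re_inner (𝕜 := ℂ) v).symm
      rw [herm_self_ofReal, hr, Complex.ofReal_eq_one,
        pow_eq_one_iff_of_nonneg (norm_nonneg v) two_ne_zero]
    simp only [Set.mem_ofPred_eq, Set.mem_inter_iff, mem_sphere_zero_iff_norm, ← hn, cross_self,
      smul_eq_zero, two_ne_zero, false_or]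
    exact ⟨fun h => ⟨h.1, h.2⟩, fun h => ⟨h.1, h.2⟩⟩
  have hk : IsCompact {v : H3 | IsRankOne v} := by
    rw [hset]
    exact (isCompact_sphere 0 1).inter_left (isClosed_eq hc continuous_const)
  have hcont : Continuous fun v : H3 => (herm x v).re := by
    simp only [hh]
    fun_prop
  obtain ⟨v, hv, hmax⟩ := hk.exists_isMaxOn ⟨idem 0, isRankOne_idem 0⟩ hcont.continuousOn
  exact ⟨v, hv, fun w hw => hmax hw⟩

theorem eq_zero_of_mul_le_sq {a K : ℝ} (hK : 0 ≤ K) (h : ∀ t : ℝ, |t| ≤ 1 → t * a ≤ t ^ 2 * K) :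
    a = 0 := by
  by_contra ha
  have hp : 0 < |a| := abs_pos.2 ha
  have hD : 0 < 1 + |a| + K := by positivity
  -- This $t$ has $|t|\le1$, and $tK<a$ in absolute value, so $t^2K<ta$ unless $a=0$.
  have h1 := h (a / (1 + |a| + K)) (by
    rw [abs_div, abs_of_pos hD, div_le_one hD]
    linarith)
  rw [div_mul_eq_mul_div, div_pow, div_mul_eq_mul_div, div_le_div_iff₀ hD (by positivity)] at h1
  have h2 : 0 < a * a := mul_self_pos.2 ha
  have h3 : a * a * (1 + |a| + K) * (1 + |a|) ≤ 0 := by nlinarith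
  have h4 : 0 < a * a * (1 + |a| + K) * (1 + |a|) := by positivity
  linarith

theorem isRankOne_rescale {y : H3} (hy : adj y = 0) (h0 : y ≠ 0) :
    ∃ s : ℝ, 0 < s ∧ s ^ 2 = (herm y y).re ∧ IsRankOne (((s⁻¹ : ℝ) : ℂ) • y) := by
  have h1 : (herm y y).re ≠ 0 := fun h => h0 (eq_zero_of_herm_self (by
    rw [herm_self_ofReal, h, Complex.ofReal_zero]))
  have h2 : 0 < (herm y y).re := (herm_self_nonneg y).lt_of_ne h1.symm
  have hs := Real.sq_sqrt h2.le
  have hs0 := Real.sqrt_pos.2 h2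
  refine ⟨√(herm y y).re, hs0, hs, by rw [adj_smul, hy, smul_zero], ?_⟩
  rw [herm_smul_left, herm_smul_right, Complex.conj_ofReal, herm_self_ofReal y]
  norm_cast
  rw [← hs]
  field_simp
  rw [Real.sqrt_sq hs0.le]

/-- A maximum over the elements of rank one bounds the whole cone `y^# = 0`. -/
theorem herm_le_of_max {x : H3} {m : ℝ} (hm : 0 ≤ m)
    (h : ∀ w, IsRankOne w → (herm x w).re ≤ m) {y : H3} (hy : adj y = 0) :
    (herm x y).re ≤ m * (1 + (herm y y).re) / 2 := by
  by_cases h0 : y = 0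
  · rw [h0, herm_zero_right, herm_zero_left]
    simp only [Complex.zero_re]
    linarith
  · obtain ⟨s, hs, hs2, hr⟩ := isRankOne_rescale hy h0
    have h1 := h _ hr
    rw [herm_smul_right, Complex.conj_ofReal, Complex.re_ofReal_mul, inv_mul_le_iff₀ hs] at h1
    rw [← hs2]
    -- The bound $ms\le m(1+s^2)/2$, where $s^2=(y\mid y)$.
    nlinarith [mul_nonneg hm (sq_nonneg (s - 1))]

/-- The cone $y^{\#}=0$ spans: besides the $e_i$ it contains $e_{i+1}+n(a)e_{i+2}+F_i(a)$, where the
coefficient $n(a)$ makes the $2\times2$ minor vanish. -/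
theorem eq_zero_of_herm_cone {x : H3} (h : ∀ y, adj y = 0 → herm x y = 0) : x = 0 := by
  refine Prod.ext (funext fun i => ?_) (funext fun i => ?_)
  · have := h _ (isRankOne_idem i).adj_eq
    fin_cases i <;> simpa [herm, inner, conj, idem, Fin.sum_univ_three] using this
  · by_contra hne
    have h1 := h _ (isRankOne_idem (i + 1)).adj_eq
    have h2 := h _ (isRankOne_idem (i + 2)).adj_eq
    have h3 := h (idem (i + 1) + norm (x.2 i) • idem (i + 2) + off i (x.2 i)) (by
      fin_cases i <;> refine Prod.ext (funext fun j => ?_) (funext fun j => ?_) <;>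
        fin_cases j <;> simp [idem, off, adj])
    rw [herm_add_right, herm_add_right, herm_smul_right, h1, h2] at h3
    apply inner_conj_ne_zero hne
    fin_cases i <;> simpa [herm, inner, conj, off, Fin.sum_univ_three] using h3

/-- For `v` of rank one and `z` in `V_1(v)`, a parabola of elements with `y^# = 0` through `v` in
the direction `z`. -/
theorem adj_parabola {v z : H3} (hv : IsRankOne v) (hz : cross v z = 0) (hvz : herm z v = 0)
    (t : ℂ) : adj (v + t • z - t ^ 2 • cross (adj z) (conj v)) = 0 := by
  set q := cross (adj z) (conj v) with hq
  have h1 : inner (adj z) v = 0 := by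
    have : inner (cross z z) v = 0 := by
      rw [inner_cross, cross_comm z v, hz, inner_zero]
    rw [cross_self, smul_inner] at this
    simpa using this
  have hN : cubic z • v = 0 := by
    have := adj_cross_cross z v
    rw [cross_comm z v, hz, cross_zero, h1, zero_smul, add_zero] at this
    exact this.symm
  have hN' : cubic z = 0 := (smul_eq_zero.1 hN).resolve_right hv.ne_zero
  have hvz' : inner z (conj v) = 0 := hvz
  have h2 : cross z q = 0 := by
    rw [hq, cross_adj_cross, hN', hvz', zero_smul, zero_smul, add_zero]
  -- The reason for the choice of $q$: it cancels the $t^2$ term $z^{\#}$ of the adjoint. The terms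
  -- in $t$, $t^3$, $t^4$ vanish by `hz`, `h2`, `h4`.
  have h3 : cross v q = adj z := by
    have := cross_adj_cross_add z v (conj v)
    rw [cross_comm z v, hz, zero_cross, cross_zero, h1, hvz', show inner v (conj v) = 1 from
      hv.herm_eq] at this
    simpa using this
  have h4 : adj q = 0 := by
    rw [hq, cross_comm, IsRankOne.adj_cross hv.adj_conj_eq, adj_adj, hN', zero_smul, inner_zero,
      zero_smul]
  rw [sub_eq_add_neg, ← neg_smul, adj_add, adj_add]
  simp only [adj_smul, cross_smul, add_cross, smul_cross, hv.adj_eq, hz, h2, h3, h4]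
  module

/-- Every `x` splits as `λ v + w` with `v` of rank one and `w` in `V_0(v)`. -/
theorem exists_eq_smul_add_projZero {x : H3} (hx : x ≠ 0) :
    ∃ v, IsRankOne v ∧ herm x v ≠ 0 ∧ x = herm x v • v + projZero v x := by
  obtain ⟨v, hv, hmax⟩ := exists_isRankOne_max x
  set m := (herm x v).re with hm
  have hm0 : 0 ≤ m := by
    have := hmax _ (hv.smul (t := -1) (by simp))
    rw [herm_smul_right] at this
    simp at this
    linarith
  have hcone := fun {y} => herm_le_of_max (x := x) (y := y) hm0 hmax
  refine ⟨v, hv, fun h0 => hx (eq_zero_of_herm_cone fun y hy => ?_), ?_⟩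
  -- If $(x\mid v)=0$ the maximum is $0$, so $\operatorname{Re}(x\mid\cdot)\le0$ on the cone; at
  -- $(x\mid y)y$ its value is $|(x\mid y)|^2$.
  · have h1 := hcone (y := herm x y • y) (by rw [adj_smul, hy, smul_zero])
    rw [hm, h0, herm_smul_right, ← Complex.normSq_eq_conj_mul_self] at h1
    simp at h1
    exact Complex.normSq_eq_zero.1 (le_antisymm h1 (Complex.normSq_nonneg _))
  -- The component of $x$ in $V_1(v)$, to be shown zero.
  · set z := x - herm x v • v - projZero v x with hz
    have hvz : cross v z = 0 := by
      rw [hz, cross_sub, cross_sub, cross_smul, cross_self, hv.adj_eq, hv.cross_projZero]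
      module
    have hzv : herm z v = 0 := by
      rw [hz, herm_sub_left, herm_sub_left, herm_smul_left, hv.herm_eq, hv.herm_projZero_self]
      ring
    have hxz : herm x z = herm z z := by
      have e : x = z + herm x v • v + projZero v x := by rw [hz]; module
      have e1 : herm v z = 0 := by rw [herm_comm, hzv, map_zero]
      have e2 : herm (projZero v x) z = 0 := by
        rw [herm_projZero, projZero_apply, hvz, zero_cross, herm_zero_right]
      conv_lhs => rw [e]
      rw [herm_add_left, herm_add_left, herm_smul_left, e1, e2]
      ring
    set q := cross (adj z) (conj v) with hq
    have hqv : herm q v = 0 := by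
      rw [herm, hq, inner_cross, cross_self, hv.adj_conj_eq, smul_zero, inner_zero]
    have hvz' : herm v z = 0 := by rw [herm_comm, hzv, map_zero]
    have hvq : herm v q = 0 := by rw [herm_comm, hqv, map_zero]
    have hqz : (herm q z).re = (herm z q).re := by rw [herm_comm, Complex.conj_re]
    have ha : (herm x z).re = 0 := by
      -- Apply the cone bound along the parabola $v+tz-t^2q$. The constants $m$ cancel, leaving
      -- $t\operatorname{Re}(x\mid z)$ against terms of order $t^2$, bounded by $Kt^2$ for
      -- $|t|\le1$.
      refine eq_zero_of_mul_le_sq (K := |(herm x q).re| +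
        m * ((herm z z).re + 2 * |(herm z q).re| + (herm q q).re) / 2) ?_ fun t ht => ?_
      · have := herm_self_nonneg z
        have := herm_self_nonneg q
        positivity
      · have h1 := hcone (adj_parabola hv hvz hzv (t : ℂ))
        rw [← hq] at h1
        simp only [herm_add_left, herm_add_right, herm_sub_left, herm_sub_right, herm_smul_left,
          herm_smul_right, hv.herm_eq, hzv, hvz', hqv, hvq, Complex.conj_ofReal,
          ← Complex.ofReal_pow, Complex.add_re, Complex.sub_re, Complex.re_ofReal_mul, ← hm,
          Complex.one_re, Complex.zero_re, hqz] at h1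
        have b1 := le_abs_self (herm x q).re
        have b2 : -(t * (herm z q).re) ≤ |(herm z q).re| := by
          refine (neg_le_abs _).trans ?_
          rw [abs_mul]
          exact mul_le_of_le_one_left (abs_nonneg _) ht
        have b3 : t ^ 2 * (herm q q).re ≤ (herm q q).re :=
          mul_le_of_le_one_left (herm_self_nonneg q) ((sq_le_one_iff_abs_le_one t).2 ht)
        have b4 : t ^ 2 * (m * ((herm z z).re + 2 * -(t * (herm z q).re) + t ^ 2 * (herm q q).re)) ≤
            t ^ 2 * (m * ((herm z z).re + 2 * |(herm z q).re| + (herm q q).re)) := by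
          gcongr
        have b5 : t ^ 2 * (herm x q).re ≤ t ^ 2 * |(herm x q).re| := by gcongr
        linarith
    have hz0 : z = 0 := eq_zero_of_herm_self (by
      rw [herm_self_ofReal, ← hxz, ha, Complex.ofReal_zero])
    rw [hz0] at hz
    linear_combination (norm := module) -(1 : ℂ) • hz

theorem isRankOne_of_isMinimalTripotent {u : H3} (hu : HermitianJTS.IsMinimalTripotent triple u) :
    IsRankOne u := by
  obtain ⟨hut, hu0, hmin⟩ := hu
  obtain ⟨v, hv, hl, huv⟩ := exists_eq_smul_add_projZero hu0
  set l := herm u v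
  set w := projZero v u with hw
  have hvw : triple v w = 0 := hv.triple_eq_zero_iff.2 (hv.projZero_projZero u)
  have hwv := triple_eq_zero_symm hvw
  -- Cubing respects the orthogonal splitting $u=\lambda v+w$; pairing with $v$ then gives
  -- $|\lambda|=1$.
  have hQ : (l * starRingEnd ℂ l * l) • v + HermitianJTS.Q triple w w = l • v + w := by
    have h : HermitianJTS.Q triple u u = u := hut
    rw [huv, HermitianJTS.Q] at h
    simp only [map_add, LinearMap.map_smulₛₗ, LinearMap.add_apply, LinearMap.smul_apply, hvw, hwv,
      LinearMap.zero_apply, triple_comm v v w, triple_comm w w v, hv.triple_self_self,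
      RingHom.id_apply, LinearMap.zero_apply] at h
    rw [HermitianJTS.Q]
    linear_combination (norm := module) h
  have hQv : herm (HermitianJTS.Q triple w w) v = 0 := by
    rw [HermitianJTS.Q, herm_smul_left, herm_triple, triple_comm w w v, hvw, LinearMap.zero_apply,
      herm_zero_right, mul_zero]
  have hwv' : herm w v = 0 := hv.herm_projZero_self u
  have hll : l * starRingEnd ℂ l = 1 := by
    have h := congrArg (fun a => herm a v) hQ
    simp only [herm_add_left, herm_smul_left, hv.herm_eq, hQv, hwv'] at h
    refine mul_right_cancel₀ hl ?_
    linear_combination h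
  have hlv := hv.smul hll
  have hwt : HermitianJTS.IsTripotent triple w := by
    rw [hll, one_mul] at hQ
    exact add_left_cancel hQ
  rcases hmin (l • v) w hlv.isTripotent hwt (by
    rw [HermitianJTS.IsOrthogonal, map_smul, LinearMap.smul_apply, hvw, smul_zero]) huv with h | h
  · exact absurd h hlv.ne_zero
  · rw [huv, h, add_zero]
    exact hlv

/-! ### Frames -/

namespace IsRankOne

variable {u v w : H3}

theorem herm_eq_zero (hv : IsRankOne v) (h : triple v w = 0) : herm w v = 0 := by
  rw [← hv.triple_eq_zero_iff.1 h, hv.herm_projZero_self]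

theorem triple_self_eq_self_iff (hv : IsRankOne v) {z : H3} :
    triple v v z = z ↔ herm z v = 0 ∧ cross v z = 0 := by
  rw [hv.triple_self_apply]
  constructor
  · intro h
    have h1 : projZero v z = herm z v • v := by linear_combination (norm := module) -(1 : ℂ) • h
    have h2 := congrArg (fun a => herm a v) h1
    simp only [herm_smul_left, hv.herm_eq, hv.herm_projZero_self, mul_one] at h2
    refine ⟨h2.symm, ?_⟩
    rw [← hv.cross_projZero, h1, cross_smul, cross_self, hv.adj_eq, smul_zero, smul_zero]
  · rintro ⟨h1, h2⟩
    rw [projZero_apply, h1, h2, zero_cross]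
    module

/-- The joint Peirce space `V_0(v) ∩ V_0(w)` of orthogonal `v`, `w` is spanned by
the conjugate of `v × w`. -/
theorem eq_smul_conj_cross (hv : IsRankOne v) (hvw : triple v w = 0) {z : H3}
    (h1 : projZero v z = z) (h2 : projZero w z = z) :
    z = inner (cross v w) z • H3.conj (cross v w) := by
  have hvz : inner z (H3.conj v) = 0 := by
    rw [← h1]
    exact hv.herm_projZero_self z
  have hwv : inner w (H3.conj v) = 0 := hv.herm_eq_zero hvw
  have h3 : cross (cross w z) (H3.conj v) = 0 := by
    have h := congrArg (fun f => f z) (triple_eq_zero_symm hvw)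
    simp only [triple_apply, herm, hwv, hvz, LinearMap.zero_apply, zero_smul, zero_add,
      zero_sub, neg_eq_zero] at h
    exact h
  have h4 : cross (cross v w) (H3.conj v) = w := hv.triple_eq_zero_iff.1 hvw
  have h5 : cross (cross v z) (H3.conj v) = z := h1
  -- Here orthogonality reduces the linearized identity to $2\,w\times z=(v\times w:z)\bar v+w\times
  -- z$; then $z=(w\times z)\times\bar w$ is a multiple of $\bar v\times\bar w$.
  have h6 := cross_cross_cross_add v z w (H3.conj v)
  rw [h3, h4, h5, hvz, hwv, show inner v (H3.conj v) = 1 from hv.herm_eq, cross_zero,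
    cross_comm z w] at h6
  have h7 : cross w z = inner (cross v w) z • H3.conj v := by
    linear_combination (norm := module) h6
  conv_lhs => rw [← h2, projZero_apply, h7, smul_cross, ← conj_cross]

theorem isRankOne_conj_cross (hv : IsRankOne v) (hw : IsRankOne w) (hvw : triple v w = 0) :
    IsRankOne (H3.conj (cross v w)) := by
  constructor
  · rw [← conj_adj, adj_cross hv.adj_eq, hw.adj_eq, inner_zero, conj_smul, map_zero, zero_smul]
  · have h : cross (cross v w) (H3.conj v) = w := hv.triple_eq_zero_iff.1 hvw
    rw [herm, conj_conj, conj_cross, cross_comm, inner_cross, cross_comm, h, inner_comm]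
    exact hw.herm_eq

theorem projZero_conj_cross (hv : IsRankOne v) (z : H3) :
    projZero v (cross (H3.conj v) z) = cross (H3.conj v) z := by
  rw [projZero_apply, cross_comm, cross_comm v, cross_cross_cross hv.adj_conj_eq, inner_comm,
    show inner v (H3.conj v) = 1 from hv.herm_eq, one_smul]

theorem triple_conj_cross (hv : IsRankOne v) (w : H3) : triple v (H3.conj (cross v w)) = 0 := by
  rw [hv.triple_eq_zero_iff, conj_cross, hv.projZero_conj_cross]

/-- There are no four pairwise orthogonal elements of rank one. -/
theorem not_orthogonal (hu : IsRankOne u) (hv : IsRankOne v) (hw : IsRankOne w) (huv : triple u v = 0)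
    (huw : triple u w = 0) (hvw : triple v w = 0) {z : H3} (hz : IsRankOne z) (huz : triple u z = 0)
    (hvz : triple v z = 0) : triple w z ≠ 0 := by
  intro hwz
  have h1 := eq_smul_conj_cross hu huv (hu.triple_eq_zero_iff.1 huw)
    (hv.triple_eq_zero_iff.1 hvw)
  have h2 := eq_smul_conj_cross hu huv (hu.triple_eq_zero_iff.1 huz)
    (hv.triple_eq_zero_iff.1 hvz)
  have h3 := hw.herm_eq_zero hwz
  rw [h1, h2, herm_smul_left, herm_smul_right, (isRankOne_conj_cross hu hv huv).herm_eq] at h3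
  have hw0 : inner (cross u v) w ≠ 0 := fun h => hw.ne_zero (by rw [h1, h, zero_smul])
  have hz0 : inner (cross u v) z ≠ 0 := fun h => hz.ne_zero (by rw [h2, h, zero_smul])
  simp [hw0, hz0] at h3

/-- For $y^{\#}=0$ the element $\bar v\times y$ lies in the cone and in $V_0(v)$. It is nonzero for
some $y$, since the cone spans and `projZero v` has trace $10$. -/
theorem exists_orthogonal (hv : IsRankOne v) : ∃ w, IsRankOne w ∧ triple v w = 0 := by
  have h : ∃ y, adj y = 0 ∧ cross (H3.conj v) y ≠ 0 := by
    by_contra! hne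
    have h1 : ∀ z, cross (H3.conj v) z = 0 := fun z => eq_zero_of_herm_cone fun y hy => by
      rw [cross_comm, herm, inner_cross, hne (H3.conj y) (by rw [← conj_adj, hy, ← zero_smul ℂ
        (0 : H3), conj_smul, map_zero, zero_smul, zero_smul]), inner_zero]
    have h2 : projZero v = 0 := LinearMap.ext fun z => by
      rw [projZero_apply, cross_comm, h1, LinearMap.zero_apply]
    have h3 := hv.trace_projZero
    rw [h2, map_zero] at h3
    norm_num at h3
  obtain ⟨y, hy, hvy⟩ := h
  obtain ⟨s, -, -, hs⟩ := isRankOne_rescale (y := cross (H3.conj v) y)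
    (by rw [adj_cross hv.adj_conj_eq, hy, inner_zero, zero_smul]) hvy
  refine ⟨_, hs, hv.triple_eq_zero_iff.2 ?_⟩
  rw [map_smul, hv.projZero_conj_cross]

/-- If `u`, `v`, `w` are pairwise orthogonal and `z` lies in `V_0(w)`, orthogonally to `v`, then
`u × z = 0`. -/
theorem cross_eq_zero (hu : IsRankOne u) (hv : IsRankOne v) (hw : IsRankOne w)
    (huv : triple u v = 0) (huw : triple u w = 0) (hvw : triple v w = 0) {z : H3}
    (hz : projZero w z = z) (hzv : herm z v = 0) : cross u z = 0 := by
  have hwu := triple_eq_zero_symm huw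
  have h1 := eq_smul_conj_cross hw hwu
    (hw.triple_eq_zero_iff.1 (triple_eq_zero_symm hvw)) (hu.triple_eq_zero_iff.1 huv)
  have h0 : inner (cross w u) v ≠ 0 := fun h => hv.ne_zero (by rw [h1, h, zero_smul])
  have h2 : inner z (cross w u) = 0 := by
    rw [h1, herm_smul_right, herm, conj_conj] at hzv
    exact (mul_eq_zero.1 hzv).resolve_left (by simpa using h0)
  have h3 : u = cross (H3.conj w) (cross w u) := by
    rw [cross_comm]
    exact (hw.triple_eq_zero_iff.1 hwu).symm
  have h4 : z = cross (H3.conj w) (cross w z) := by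
    rw [cross_comm]
    exact hz.symm
  rw [cross_comm]
  -- Both factors now have the form $\bar w\times\cdot$, so `cross_cross` gives $z\times
  -- u=(z:w\times u)\bar w$; the coefficient vanishes because $v$ is a nonzero multiple of
  -- $\overline{w\times u}$.
  conv_lhs => rw [h4, h3]
  rw [cross_cross hw.adj_conj_eq, ← h4, h2, zero_smul]

end IsRankOne

/-! ### Joint Peirce spaces and the invariants of frames -/

theorem mem_jointPeirce {n : ℕ} {c : Fin n → H3} {i j : Fin (n + 1)} {z : H3} :
    z ∈ HermitianJTS.jointPeirce triple c i j ↔ ∀ k : Fin n, triple (c k) (c k) z =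
      (((if i = k.succ then 1 else 0) + (if j = k.succ then 1 else 0) : ℕ) : ℂ) • z := by
  simp only [HermitianJTS.jointPeirce, HermitianJTS.peirce, Submodule.mem_iInf,
    Module.End.mem_eigenspace_iff]

theorem IsRankOne.of_isFrame {n : ℕ} {c : Fin n → H3} (hc : HermitianJTS.IsFrame triple c)
    (i : Fin n) : IsRankOne (c i) := isRankOne_of_isMinimalTripotent (hc.minimal i)

/-- Dimension of the off-diagonal Peirce space of three pairwise orthogonal elements. -/
theorem finrank_of_mem_iff {u v w : H3} (hu : IsRankOne u) (hv : IsRankOne v) (hw : IsRankOne w)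
    (huv : triple u v = 0) (huw : triple u w = 0) (hvw : triple v w = 0) {S : Submodule ℂ H3}
    (hS : ∀ z, z ∈ S ↔ triple u u z = z ∧ triple v v z = z ∧ triple w w z = 0) :
    Module.finrank ℂ S = 8 := by
  -- The kernel of this surjection $V_0(w)\to\mathbb C^2$ is $S$, so $\dim S=10-2$.
  let f : LinearMap.range (projZero w) →ₗ[ℂ] ℂ × ℂ :=
    { toFun := fun z => (herm z.1 u, herm z.1 v)
      map_add' := fun a b => by simp [herm_add_left]
      map_smul' := fun t a => by simp [herm_smul_left] }
  have hwu := triple_eq_zero_symm huw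
  have hwv := triple_eq_zero_symm hvw
  have hvu := triple_eq_zero_symm huv
  have hker : (LinearMap.ker f).map (LinearMap.range (projZero w)).subtype = S := by
    ext z
    rw [hS, hw.triple_self_eq_zero_iff, hu.triple_self_eq_self_iff, hv.triple_self_eq_self_iff]
    constructor
    · rintro ⟨⟨z, hz⟩, hz0, rfl⟩
      have hzw := hw.mem_range_projZero.1 hz
      have h0 : herm z u = 0 ∧ herm z v = 0 := Prod.mk.inj hz0
      exact ⟨⟨h0.1, IsRankOne.cross_eq_zero hu hv hw huv huw hvw hzw h0.2⟩,
        ⟨h0.2, IsRankOne.cross_eq_zero hv hu hw hvu hvw huw hzw h0.1⟩, hzw⟩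
    · rintro ⟨⟨h1, -⟩, ⟨h2, -⟩, h3⟩
      exact ⟨⟨z, hw.mem_range_projZero.2 h3⟩, Prod.ext h1 h2, rfl⟩
  have hrange : LinearMap.range f = ⊤ := by
    refine LinearMap.range_eq_top.2 fun p => ?_
    refine ⟨p.1 • ⟨u, hw.mem_range_projZero.2 (hw.triple_eq_zero_iff.1 hwu)⟩ +
      p.2 • ⟨v, hw.mem_range_projZero.2 (hw.triple_eq_zero_iff.1 hwv)⟩, ?_⟩
    rw [map_add, map_smul, map_smul]
    refine Prod.ext ?_ ?_
    · change p.1 * herm u u + p.2 * herm v u = p.1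
      rw [hu.herm_eq, hu.herm_eq_zero huv]
      ring
    · change p.1 * herm u v + p.2 * herm v v = p.2
      rw [hv.herm_eq, hv.herm_eq_zero hvu]
      ring
  have h := f.finrank_range_add_finrank_ker
  rw [hrange, finrank_top, hw.finrank_range_projZero, Module.finrank_prod, Module.finrank_self] at h
  rw [← hker, Submodule.finrank_map_subtype_eq]
  omega

theorem isFrame_idem : HermitianJTS.IsFrame triple idem := by
  have ho : ∀ i j, i ≠ j → triple (idem i) (idem j) = 0 := by
    intro i j hij
    rw [(isRankOne_idem i).triple_eq_zero_iff, ← (isRankOne_idem i).triple_self_eq_zero_iff,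
      triple_idem]
    simp [idem, hij]
  refine ⟨fun i => (isRankOne_idem i).isMinimalTripotent, ho, ?_⟩
  rintro ⟨e, he, heo⟩
  exact (isRankOne_idem 0).not_orthogonal (isRankOne_idem 1) (isRankOne_idem 2)
    (ho 0 1 (by decide)) (ho 0 2 (by decide)) (ho 1 2 (by decide))
    (isRankOne_of_isMinimalTripotent he) (triple_eq_zero_symm (heo 0))
    (triple_eq_zero_symm (heo 1)) (triple_eq_zero_symm (heo 2))

/-- Families of length $0$, $1$, $2$ are extended by an $e_i$, by `exists_orthogonal` and by
$\overline{c_1\times c_2}$; four members contradict `not_orthogonal`. -/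
theorem isFrame_length {n : ℕ} {c : Fin n → H3} (hc : HermitianJTS.IsFrame triple c) : n = 3 := by
  have hr := IsRankOne.of_isFrame hc
  have ho : ∀ i j, i ≠ j → triple (c i) (c j) = 0 := hc.orthogonal
  rcases lt_trichotomy n 3 with h | h | h
  · refine absurd ?_ hc.maximal
    interval_cases n
    · exact ⟨idem 0, (isRankOne_idem 0).isMinimalTripotent, fun i => i.elim0⟩
    · obtain ⟨w, hw, hvw⟩ := (hr 0).exists_orthogonal
      refine ⟨w, hw.isMinimalTripotent, fun i => ?_⟩
      rw [Subsingleton.elim i 0]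
      exact triple_eq_zero_symm hvw
    · have h01 := ho 0 1 (by decide)
      refine ⟨_, ((hr 0).isRankOne_conj_cross (hr 1) h01).isMinimalTripotent, fun i => ?_⟩
      refine triple_eq_zero_symm ?_
      fin_cases i
      · exact (hr 0).triple_conj_cross _
      · change triple (c 1) _ = 0
        rw [cross_comm]
        exact (hr 1).triple_conj_cross _
  · exact h
  · have ho' : ∀ a b : ℕ, ∀ (ha : a < n) (hb : b < n), a ≠ b → triple (c ⟨a, ha⟩) (c ⟨b, hb⟩) = 0 :=
      fun a b ha hb hab => ho _ _ fun h => hab (congrArg Fin.val h)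
    refine absurd (ho' 2 3 (by omega) (by omega) (by decide)) ?_
    exact (hr ⟨0, by omega⟩).not_orthogonal (hr ⟨1, by omega⟩) (hr _) (ho' 0 1 _ _ (by decide))
      (ho' 0 2 _ _ (by decide)) (ho' 1 2 _ _ (by decide)) (hr _) (ho' 0 3 _ _ (by decide))
      (ho' 1 3 _ _ (by decide))

theorem finrank_jointPeirce {c : Fin 3 → H3} (hc : HermitianJTS.IsFrame triple c) {i j : Fin 3}
    (hij : i < j) :
    Module.finrank ℂ (HermitianJTS.jointPeirce triple c i.succ j.succ) = 8 := by
  have hr := IsRankOne.of_isFrame hc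
  have ho : ∀ i j, i ≠ j → triple (c i) (c j) = 0 := hc.orthogonal
  obtain ⟨k, hki, hkj, hk⟩ : ∃ k : Fin 3, i ≠ k ∧ j ≠ k ∧ ∀ l, l = i ∨ l = j ∨ l = k := by
    decide +revert
  refine finrank_of_mem_iff (hr i) (hr j) (hr k) (ho i j hij.ne) (ho i k hki) (ho j k hkj)
    fun z => ?_
  rw [mem_jointPeirce]
  simp only [Fin.succ_inj]
  constructor
  · intro h
    have hi := h i
    have hj := h j
    have hk := h k
    simp [hij.ne, hij.ne', hki, hkj] at hi hj hk
    exact ⟨hi, hj, hk⟩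
  · rintro ⟨h1, h2, h3⟩ l
    rcases hk l with rfl | rfl | rfl
    · simp [hij.ne', h1]
    · simp [hij.ne, h2]
    · simp [hki, hkj, h3]

/-- Such a $z$ lies in $V_0(c_j)\cap V_0(c_k)=\mathbb Cc_i$, while $D(c_i,c_i)z=z$ forces $(z\mid
c_i)=0$. -/
theorem finrank_jointPeirce_zero {c : Fin 3 → H3} (hc : HermitianJTS.IsFrame triple c)
    (i : Fin 3) : Module.finrank ℂ (HermitianJTS.jointPeirce triple c 0 i.succ) = 0 := by
  have hr := IsRankOne.of_isFrame hc
  have ho : ∀ i j, i ≠ j → triple (c i) (c j) = 0 := hc.orthogonal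
  obtain ⟨j, k, hji, hki, hjk⟩ : ∃ j k : Fin 3, j ≠ i ∧ k ≠ i ∧ j ≠ k := by decide +revert
  refine Submodule.finrank_eq_zero.2 ((Submodule.eq_bot_iff _).2 fun z hz => ?_)
  rw [mem_jointPeirce] at hz
  simp only [Fin.succ_inj] at hz
  have hi := hz i
  have hj := hz j
  have hk := hz k
  simp [hji.symm, hki.symm, (Fin.succ_ne_zero _).symm] at hi hj hk
  rw [(hr j).triple_self_eq_zero_iff] at hj
  rw [(hr k).triple_self_eq_zero_iff] at hk
  have h1 := (hr j).eq_smul_conj_cross (ho j k hjk) hj hk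
  have h2 := (hr j).eq_smul_conj_cross (ho j k hjk)
    ((hr j).triple_eq_zero_iff.1 (ho j i hji)) ((hr k).triple_eq_zero_iff.1 (ho k i hki))
  have h3 := ((hr i).triple_self_eq_self_iff.1 hi).1
  rw [h1, h2, herm_smul_left, herm_smul_right,
    ((hr j).isRankOne_conj_cross (hr k) (ho j k hjk)).herm_eq] at h3
  have h0 : inner (cross (c j) (c k)) (c i) ≠ 0 := fun h => (hr i).ne_zero (by
    rw [h2, h, zero_smul])
  rw [h1]
  simp [h0] at h3
  rw [h3, zero_smul]

theorem hasNumericalInvariants :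
    HermitianJTS.HasNumericalInvariants triple (a := 8) (b := 0) (r := 3) (g := 18) where
  rank := hasRank
  exists_frame := ⟨idem, isFrame_idem⟩
  frame_length _ _ hc := isFrame_length hc
  finrank_a _ hc _ _ hij := finrank_jointPeirce hc hij
  finrank_b _ hc i := finrank_jointPeirce_zero hc i
  genus := by norm_num

end H3

theorem theorem2p13 :
    HermitianJTS.IsHermitianJTS H3.triple ∧
    HermitianJTS.IsPositive H3.triple ∧
    HermitianJTS.IsSimple H3.triple ∧
    HermitianJTS.IsTubeType H3.triple ∧
    HermitianJTS.HasNumericalInvariants H3.triple (a := 8) (b := 0) (r := 3) (g := 18) :=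
  ⟨H3.isHermitianJTS, H3.isPositive, H3.isSimple, H3.isTubeType, H3.hasNumericalInvariants⟩
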